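/- Let $\mathcal H$ be a separable complex Hilbert space, let $\alpha>1$ and $z>0$, and let $\varrho,\sigma$ be non-zero positive semi-definite bounded operators on $\mathcal H$. Real powers are defined by the functional calculus, $A^0$ denotes the projection onto $(\ker A)^\perp$, and $\operatorname{Tr}$ takes values in $[0,+\infty]$ on positive semi-definite operators. If there is a bounded operator $R$ on $\mathcal H$ with $\varrho^{\alpha/z}=\sigma^{\frac{\alpha-1}{2z}}R\,\sigma^{\frac{\alpha-1}{2z}}$, then there is a unique positive semi-definite such $R$ with $R^0\le\sigma^0$; call it $\varrho_{\sigma,\alpha,z}$ and let $Q_{\alpha,z}(\varrho\|\sigma):=\operatorname{Tr}(\varrho_{\sigma,\alpha,z})^z$. If there is no such $R$, let $Q_{\alpha,z}(\varrho\|\sigma):=+\infty$. Let $D_{\alpha,z}(\varrho\|\sigma):=\frac1{\alpha-1}\log Q_{\alpha,z}(\varrho\|\sigma)$. (1) If $\sigma$ is trace-class, then $$Q_{\alpha,z}(\varrho\|\sigma)\ \ge\ (\operatorname{Tr}\varrho)^{\alpha}(\operatorname{Tr}\sigma)^{1-\alpha}\ \ge\ \alpha\operatorname{Tr}\varrho+(1-\alpha)\operatorname{Tr}\sigma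 .$$ (2) If both $\varrho$ and $\sigma$ are trace-class, then $$Q_{\alpha,z}(\varrho\|\sigma)=(\operatorname{Tr}\varrho)^{\alpha}(\operatorname{Tr}\sigma)^{1-\alpha}\iff \sigma=\eta\varrho\ \text{ for some }\eta\in(0,+\infty),$$ $$Q_{\alpha,z}(\varrho\|\sigma)=\alpha\operatorname{Tr}\varrho+(1-\alpha)\operatorname{Tr}\sigma\iff \sigma=\varrho .$$ (3) For any two density operators $\varrho,\sigma$ on $\mathcal H$ (positive semi-definite operators of trace $1$), $D_{\alpha,z}(\varrho\|\sigma)\ge 0$, with equality if and only if $\varrho=\sigma$. -/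

import Mathlib

open scoped NNReal ENNReal

namespace RenyiAZ

section Trace

variable {H : Type*} [NormedAddCommGroup H] [InnerProductSpace ℂ H] [CompleteSpace H]

/-- The trace, with values in `[0, ∞]`, of a positive semi-definite bounded operator:
`Tr A = ∑ᵢ ⟨eᵢ, A eᵢ⟩`, where `(eᵢ)` is an orthonormal basis of `H`. The value does not depend on
the basis, see `trace_eq_tsum`. -/
noncomputable def trace (A : H →L[ℂ] H) : ℝ≥0∞ :=
  ∑' i : (exists_hilbertBasis ℂ H).choose,
    ENNReal.ofReal (RCLike.re (inner ℂ (i : H) (A (i : H))))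

set_option linter.unusedSectionVars false in
theorem ofReal_norm_sq_eq_tsum {ι : Type*} (b : HilbertBasis ι ℂ H) (x : H) :
    ENNReal.ofReal (‖x‖ ^ 2) = ∑' i, ENNReal.ofReal (‖inner ℂ (b i) x‖ ^ 2) := by
  have h := b.hasSum_inner_mul_inner x x
  have h2 : HasSum (fun i => ‖inner ℂ (b i) x‖ ^ 2) (‖x‖ ^ 2) := by
    have h3 := h.mapL (RCLike.reCLM (K := ℂ))
    convert! h3 using 1
    · funext i
      rw [← inner_conj_symm x (b i), RCLike.conj_mul]
      norm_cast
    · simp [← inner_self_eq_norm_sq (𝕜 := ℂ)]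
  rw [← h2.tsum_eq, ENNReal.ofReal_tsum_of_nonneg (fun _ => by positivity) h2.summable]

theorem tsum_basis_eq {ι κ : Type*} (b : HilbertBasis ι ℂ H) (c : HilbertBasis κ ℂ H)
    {A : H →L[ℂ] H} (hA : 0 ≤ A) :
    ∑' i, ENNReal.ofReal (RCLike.re (inner ℂ (b i) (A (b i)))) =
      ∑' j, ENNReal.ofReal (‖CFC.sqrt A (c j)‖ ^ 2) := by
  set S := CFC.sqrt A with hS
  have hSS : S * S = A := CFC.sqrt_mul_sqrt_self A hA
  have hSsa : ∀ x y, inner ℂ (S x) y = inner ℂ x (S y) :=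
    ((ContinuousLinearMap.nonneg_iff_isPositive S).1 (CFC.sqrt_nonneg A)).isSymmetric
  have h1 : ∀ x, RCLike.re (inner ℂ x (A x)) = ‖S x‖ ^ 2 := by
    intro x
    rw [← hSS, mul_apply_eq_comp, ← hSsa, inner_self_eq_norm_sq]
  simp_rw [h1, ofReal_norm_sq_eq_tsum c (S (b _)), ofReal_norm_sq_eq_tsum b (S (c _))]
  rw [ENNReal.tsum_comm]
  refine tsum_congr fun j => tsum_congr fun i => ?_
  rw [← hSsa, norm_inner_symm]

theorem trace_eq_tsum {ι : Type*} (b : HilbertBasis ι ℂ H) {A : H →L[ℂ] H} (hA : 0 ≤ A) :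
    trace A = ∑' i, ENNReal.ofReal (RCLike.re (inner ℂ (b i) (A (b i)))) := by
  obtain ⟨c, hc⟩ := (exists_hilbertBasis ℂ H).choose_spec
  rw [tsum_basis_eq b b hA, ← tsum_basis_eq c b hA, hc]
  rfl

/-- Density operators (states): positive semi-definite operators of trace one. -/
def IsDensity (A : H →L[ℂ] H) : Prop := 0 ≤ A ∧ trace A = 1

end Trace

section Divergence

variable {H : Type*} [NormedAddCommGroup H] [InnerProductSpace ℂ H] [CompleteSpace H]

/-- The support projection of a positive semi-definite operator `A`: the orthogonal projection
onto `(ker A)ᗮ`, usually denoted by `A⁰`. -/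
noncomputable def suppProj (A : H →L[ℂ] H) : H →L[ℂ] H :=
  (A.kerᗮ).starProjection

theorem suppProj_le_iff {A B : H →L[ℂ] H} : suppProj A ≤ suppProj B ↔ B.ker ≤ A.ker := by
  unfold suppProj
  rw [Submodule.starProjection_le_starProjection_iff]
  refine ⟨fun h => ?_, fun h => Submodule.orthogonal_le h⟩
  have h0 := Submodule.orthogonal_le h
  have h1 : IsClosed (A.ker : Set H) := A.isClosed_ker
  have h2 : IsClosed (B.ker : Set H) := B.isClosed_ker
  have := h1.completeSpace_coe
  have := h2.completeSpace_coe
  rwa [Submodule.orthogonal_orthogonal, Submodule.orthogonal_orthogonal] at h0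

theorem sqrt_apply_eq_zero {A : H →L[ℂ] H} (hA : 0 ≤ A) {x : H} (hx : A x = 0) :
    CFC.sqrt A x = 0 := by
  have hSS : CFC.sqrt A * CFC.sqrt A = A := CFC.sqrt_mul_sqrt_self A hA
  have hS := ((ContinuousLinearMap.nonneg_iff_isPositive _).1 (CFC.sqrt_nonneg A)).isSymmetric
  have : inner ℂ (CFC.sqrt A x) (CFC.sqrt A x) = 0 := by
    have h := hS x (CFC.sqrt A x)
    refine h.trans ?_
    change inner ℂ x ((CFC.sqrt A * CFC.sqrt A) x) = 0
    rw [hSS, hx, inner_zero_right]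
  exact inner_self_eq_zero.1 this

theorem rpow_apply_eq_zero {A : H →L[ℂ] H} (hA : 0 ≤ A) {p : ℝ} (hp : 0 < p) {x : H}
    (hx : A x = 0) : (A ^ p) x = 0 := by
  have key : ∀ n : ℕ, (A ^ ((1 / 2 : ℝ≥0) ^ n)) x = 0 := by
    intro n
    induction n with
    | zero => rw [pow_zero, CFC.nnrpow_one A hA]; exact hx
    | succ n ih =>
      have h0 : 0 ≤ A ^ ((1 / 2 : ℝ≥0) ^ n) := CFC.nnrpow_nonneg
      have h1 := sqrt_apply_eq_zero h0 ih
      have h2 : (1 / 2 : ℝ≥0) ^ (n + 1) = (1 / 2 : ℝ≥0) ^ n / 2 := by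
        rw [pow_succ, one_div, div_eq_mul_inv]
      rw [CFC.sqrt_nnrpow] at h1
      rw [h2]
      exact h1
  obtain ⟨n, hn⟩ := exists_pow_lt_of_lt_one (y := (1 / 2 : ℝ≥0)) (Real.toNNReal_pos.2 hp)
    (by rw [← NNReal.coe_lt_coe]; norm_num)
  have h1 : A ^ p = A ^ (p.toNNReal) := by
    rw [CFC.nnrpow_eq_rpow (Real.toNNReal_pos.2 hp), Real.coe_toNNReal _ hp.le]
  rw [h1, ← tsub_add_cancel_of_le hn.le,
    CFC.nnrpow_add (tsub_pos_of_lt hn) (by positivity), mul_apply_eq_comp, key,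
    map_zero]

theorem ker_rpow {A : H →L[ℂ] H} (hA : 0 ≤ A) {p : ℝ} (hp : 0 < p) :
    (A ^ p).ker = A.ker := by
  ext x
  constructor
  · intro hx
    have h := rpow_apply_eq_zero (A := A ^ p) CFC.rpow_nonneg (inv_pos.2 hp) hx
    have h2 : (A ^ p) ^ p⁻¹ = A := by
      rw [CFC.rpow_rpow_of_exponent_nonneg A p p⁻¹ hp.le (inv_pos.2 hp).le hA,
        mul_inv_cancel₀ hp.ne', CFC.rpow_one A hA]
    rw [h2] at h
    exact h
  · intro hx
    exact rpow_apply_eq_zero hA hp hx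

theorem selfAdjoint_closure_range {s : H →L[ℂ] H} (hs : 0 ≤ s) :
    closure (Set.range s) = (s.kerᗮ : Set H) := by
  have h := ((ContinuousLinearMap.nonneg_iff_isPositive s).1 hs).isSelfAdjoint
  have := s.orthogonal_ker
  rw [h.adjoint_eq] at this
  rw [this]
  rfl

set_option linter.unusedSectionVars false in
theorem inner_sandwich {s R : H →L[ℂ] H} (hs : 0 ≤ s) (x y : H) :
    inner ℂ ((s * R * s) x) y = inner ℂ (R (s x)) (s y) :=
  ((ContinuousLinearMap.nonneg_iff_isPositive s).1 hs).isSymmetric _ _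

open scoped ComplexOrder in
theorem exists_psd_sandwich {σ s τ R : H →L[ℂ] H} (hs : 0 ≤ s) (hτ : 0 ≤ τ)
    (hker : s.ker = σ.ker) (h : τ = s * R * s) :
    ∃! T : H →L[ℂ] H, 0 ≤ T ∧ suppProj T ≤ suppProj σ ∧ τ = s * T * s := by
  have hsym := ((ContinuousLinearMap.nonneg_iff_isPositive s).1 hs).isSymmetric
  have hcl := selfAdjoint_closure_range hs
  have hτp := (ContinuousLinearMap.nonneg_iff_isPositive τ).1 hτ
  set K : Submodule ℂ H := s.ker with hK
  have hKc : IsClosed (K : Set H) := s.isClosed_ker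
  have := hKc.completeSpace_coe
  set P := Kᗮ.starProjection with hP
  have hPmem : ∀ x, P x ∈ Kᗮ := fun x => Kᗮ.starProjection_apply_mem x
  have hdiff : ∀ x, x - P x ∈ K := by
    intro x
    have := Kᗮ.sub_starProjection_mem_orthogonal x
    rwa [Submodule.orthogonal_orthogonal] at this
  have hsP : ∀ x, s (P x) = s x := by
    intro x
    have h0 : s (x - P x) = 0 := hdiff x
    rw [map_sub, sub_eq_zero] at h0
    exact h0.symm
  have hPs : ∀ x, P (s x) = s x := by
    intro x
    refine Submodule.starProjection_eq_self_iff.2 ?_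
    rw [← SetLike.mem_coe, ← hcl]
    exact subset_closure ⟨x, rfl⟩
  have hPK : ∀ x ∈ K, P x = 0 := by
    intro x hx
    have h1 := hPmem x
    have h2 : P x ∈ K := by
      have := K.sub_mem hx (hdiff x)
      simpa using this
    have := Submodule.inner_right_of_mem_orthogonal h2 h1
    exact inner_self_eq_zero.1 this
  have hpos : ∀ y ∈ Kᗮ, 0 ≤ inner ℂ (R y) y := by
    intro y hy
    have hy' : y ∈ closure (Set.range s) := by rw [hcl]; exact hy
    have hclosed : IsClosed {y : H | 0 ≤ inner ℂ (R y) y} :=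
      isClosed_le continuous_const (by fun_prop)
    refine closure_minimal ?_ hclosed hy'
    rintro _ ⟨x, rfl⟩
    change 0 ≤ inner ℂ (R (s x)) (s x)
    rw [← inner_sandwich hs, ← h]
    exact hτp.inner_nonneg_left x
  refine ⟨P * R * P, ⟨?_, ?_, ?_⟩, ?_⟩
  · rw [ContinuousLinearMap.nonneg_iff_isPositive, ContinuousLinearMap.isPositive_iff_complex]
    intro x
    have h1 : inner ℂ ((P * R * P) x) x = inner ℂ (R (P x)) (P x) :=
      Kᗮ.inner_starProjection_left_eq_right _ _
    have h2 := hpos (P x) (hPmem x)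
    rw [h1]
    rw [Complex.nonneg_iff] at h2
    refine ⟨?_, h2.1⟩
    apply Complex.ext
    · simp
    · simpa using h2.2
  · rw [suppProj_le_iff, ← hker]
    intro x hx
    change P (R (P x)) = 0
    rw [hPK x hx, map_zero, map_zero]
  · ext x
    change τ x = s (P (R (P (s x))))
    rw [hPs, hsP, h]
    rfl
  · rintro T ⟨hT, hTσ, hTτ⟩
    rw [suppProj_le_iff, ← hker] at hTσ
    have hTsym := ((ContinuousLinearMap.nonneg_iff_isPositive T).1 hT).isSymmetric
    have hTP : ∀ x, T (P x) = T x := by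
      intro x
      have h0 : T (x - P x) = 0 := hTσ (hdiff x)
      rw [map_sub, sub_eq_zero] at h0
      exact h0.symm
    have heq : ∀ y ∈ Kᗮ, ∀ w ∈ Kᗮ, inner ℂ (T y) w = inner ℂ (R y) w := by
      have step : ∀ x : H, ∀ w ∈ Kᗮ, inner ℂ (T (s x)) w = inner ℂ (R (s x)) w := by
        intro x w hw
        have hw' : w ∈ closure (Set.range s) := by rw [hcl]; exact hw
        have hclosed : IsClosed {w : H | inner ℂ (T (s x)) w = inner ℂ (R (s x)) w} :=
          isClosed_eq (by fun_prop) (by fun_prop)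
        refine closure_minimal ?_ hclosed hw'
        rintro _ ⟨z, rfl⟩
        change inner ℂ (T (s x)) (s z) = inner ℂ (R (s x)) (s z)
        rw [← inner_sandwich hs, ← inner_sandwich hs, ← hTτ, ← h]
      intro y hy w hw
      have hy' : y ∈ closure (Set.range s) := by rw [hcl]; exact hy
      have hclosed : IsClosed {y : H | inner ℂ (T y) w = inner ℂ (R y) w} :=
        isClosed_eq (by fun_prop) (by fun_prop)
      refine closure_minimal ?_ hclosed hy'
      rintro _ ⟨z, rfl⟩
      exact step z w hw
    ext x
    refine ext_inner_right ℂ fun w => ?_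
    have h1 : inner ℂ ((P * R * P) x) w = inner ℂ (R (P x)) (P w) :=
      Kᗮ.inner_starProjection_left_eq_right _ _
    have h2 : inner ℂ (T x) w = inner ℂ (T (P x)) (P w) := by
      have e1 : inner ℂ (T x) w = inner ℂ x (T w) := hTsym x w
      have e2 : inner ℂ (T x) (P w) = inner ℂ x (T (P w)) := hTsym x (P w)
      rw [hTP, e2, hTP, e1]
    rw [h1, h2]
    exact heq _ (hPmem x) _ (hPmem w)

/-- For positive semi-definite `ρ, σ`: the statement `ρ ∈ 𝓑^{α,z}(H, σ)`, i.e. there is a bounded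
operator `R` with `ρ^{α/z} = σ^{(α-1)/(2z)} R σ^{(α-1)/(2z)}`. The real powers of positive
semi-definite operators are those of the continuous functional calculus. -/
def MemB (α z : ℝ) (ρ σ : H →L[ℂ] H) : Prop :=
  ∃ R : H →L[ℂ] H, ρ ^ (α / z) = σ ^ ((α - 1) / (2 * z)) * R * σ ^ ((α - 1) / (2 * z))

/-- If `ρ ∈ 𝓑^{α,z}(H, σ)`, then there is a unique positive semi-definite operator `T` with
`T⁰ ≤ σ⁰` and `ρ^{α/z} = σ^{(α-1)/(2z)} T σ^{(α-1)/(2z)}`. -/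
theorem existsUnique_rhoSigma {α z : ℝ} (hα : 1 < α) (hz : 0 < z) {ρ σ : H →L[ℂ] H}
    (hσ : 0 ≤ σ) (h : MemB α z ρ σ) :
    ∃! T : H →L[ℂ] H, 0 ≤ T ∧ suppProj T ≤ suppProj σ ∧
      ρ ^ (α / z) = σ ^ ((α - 1) / (2 * z)) * T * σ ^ ((α - 1) / (2 * z)) := by
  obtain ⟨R, hR⟩ := h
  exact exists_psd_sandwich CFC.rpow_nonneg CFC.rpow_nonneg
    (ker_rpow hσ (div_pos (by linarith) (by linarith))) hR

open Classical in
/-- The operator `ρ_{σ,α,z}`: the unique positive semi-definite `T` with `T⁰ ≤ σ⁰` and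
`ρ^{α/z} = σ^{(α-1)/(2z)} T σ^{(α-1)/(2z)}`. By `existsUnique_rhoSigma` it exists and is unique for
`α > 1`, `z > 0`, `σ ≥ 0` and `ρ ∈ 𝓑^{α,z}(H, σ)`; the value `0` otherwise is irrelevant. -/
noncomputable def rhoSigma (α z : ℝ) (ρ σ : H →L[ℂ] H) : H →L[ℂ] H :=
  if h : ∃ T : H →L[ℂ] H, 0 ≤ T ∧ suppProj T ≤ suppProj σ ∧
      ρ ^ (α / z) = σ ^ ((α - 1) / (2 * z)) * T * σ ^ ((α - 1) / (2 * z))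
  then h.choose else 0

theorem rhoSigma_spec {α z : ℝ} (hα : 1 < α) (hz : 0 < z) {ρ σ : H →L[ℂ] H}
    (hσ : 0 ≤ σ) (h : MemB α z ρ σ) :
    0 ≤ rhoSigma α z ρ σ ∧ suppProj (rhoSigma α z ρ σ) ≤ suppProj σ ∧
      ρ ^ (α / z) =
        σ ^ ((α - 1) / (2 * z)) * rhoSigma α z ρ σ * σ ^ ((α - 1) / (2 * z)) := by
  have h' := (existsUnique_rhoSigma hα hz hσ h).exists
  unfold rhoSigma
  rw [dif_pos h']
  exact h'.choose_spec

open Classical in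
/-- `Q_{α,z}(ρ‖σ) = Tr (ρ_{σ,α,z})^z` if `ρ ∈ 𝓑^{α,z}(H, σ)`, and `+∞` otherwise. -/
noncomputable def Q (α z : ℝ) (ρ σ : H →L[ℂ] H) : ℝ≥0∞ :=
  if MemB α z ρ σ then trace (rhoSigma α z ρ σ ^ z) else ⊤

/-- The Rényi `(α,z)`-divergence `D_{α,z}(ρ‖σ) = (α-1)⁻¹ log Q_{α,z}(ρ‖σ)`. -/
noncomputable def D (α z : ℝ) (ρ σ : H →L[ℂ] H) : EReal :=
  ((1 / (α - 1) : ℝ) : EReal) * ENNReal.log (Q α z ρ σ)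

end Divergence

end RenyiAZ

/-! Write `T` for `rhoSigma α z ρ σ`, and put `a = σ ^ ((α - 1) / (2 * z))`, `b = √T`. The defining
relation of `T` says `(ab)(ab)* = ρ ^ (α / z)`. With `p = 2z/(α-1)`, `q = 2z`, `r = 2z/α` one has
`1/r = 1/p + 1/q`, `‖a‖_p^p = Tr σ`, `‖b‖_q^q = Q` and `‖ab‖_r^r = Tr ρ`. Young's inequality for
Schatten quasi-norms, `r⁻¹‖ab‖_r^r ≤ p⁻¹‖a‖_p^p + q⁻¹‖b‖_q^q`, is therefore exactly `α Tr ρ ≤ (α-1)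
Tr σ + Q` (`mul_trace_le_Q_add`). Equality forces `a ^ p = b ^ q`, that is `σ = T ^ z`, whence `ρ =
σ`. The multiplicative bound follows by rescaling `σ` to the trace of `ρ`, since `Q` is homogeneous
of degree `1 - α` in `σ`. For states both lower bounds equal `1`, which gives the claim on `D`.

The work lies in Young's inequality with its equality case for all positive indices
(`schattenSum_mul_le`). Finiteness of the traces makes `a` and `b` compact, so orthonormal
eigenbases and singular vectors exist. If `r ≤ 2 < q`, test on an eigenbasis of `a`: concavity of `x
^ (r/2)`, scalar Young and strict convexity of `x ^ (q/2)` bound each diagonal entry. If `p, q > 2`,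
test on singular vectors of `ab` instead. If `p ≤ 2`, write `b` as a product of equal roots with
index above `2` and peel them off one at a time by the first case. The case `q ≤ 2 < p` with `r ≤ 2`
is the first one after passing to the adjoint. -/

namespace RenyiAZ

/-! ### Jensen inequalities in vector states and their equality case -/

section FunctionalCalculus

variable {H : Type*} [NormedAddCommGroup H] [InnerProductSpace ℂ H] [CompleteSpace H]

set_option linter.unusedSectionVars false in
theorem re_inner_mono {A B : H →L[ℂ] H} (h : A ≤ B) (v : H) :
    RCLike.re (inner ℂ v (A v)) ≤ RCLike.re (inner ℂ v (B v)) := by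
  have h1 := ((ContinuousLinearMap.le_def _ _).1 h).re_inner_nonneg_right v
  rw [sub_apply, inner_sub_right, map_sub] at h1
  linarith

set_option linter.unusedSectionVars false in
theorem re_inner_nonneg {A : H →L[ℂ] H} (hA : 0 ≤ A) (v : H) :
    0 ≤ RCLike.re (inner ℂ v (A v)) :=
  ((ContinuousLinearMap.nonneg_iff_isPositive A).1 hA).re_inner_nonneg_right v

theorem norm_apply_sq_of_isSelfAdjoint {A : H →L[ℂ] H} (hA : IsSelfAdjoint A) (v : H) :
    ‖A v‖ ^ 2 = RCLike.re (inner ℂ v ((A * A) v)) := by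
  have h := hA.isSymmetric v (A v)
  rw [← inner_self_eq_norm_sq (𝕜 := ℂ)]
  exact congrArg _ h

theorem apply_eq_zero_of_re_inner_eq_zero {A : H →L[ℂ] H} (hA : 0 ≤ A) {v : H}
    (h : RCLike.re (inner ℂ v (A v)) = 0) : A v = 0 := by
  have hs : CFC.sqrt A * CFC.sqrt A = A := CFC.sqrt_mul_sqrt_self A hA
  have h1 : ‖CFC.sqrt A v‖ ^ 2 = 0 := by
    rw [norm_apply_sq_of_isSelfAdjoint (IsSelfAdjoint.of_nonneg (CFC.sqrt_nonneg A)), hs, h]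
  have h2 : CFC.sqrt A v = 0 := by simpa using h1
  rw [← hs, mul_apply_eq_comp, h2, map_zero]

/-- A vector annihilated by `g(A)` is annihilated by `f(A)` if the zeros of `g` are zeros of `f`. -/
theorem cfc_apply_eq_zero {A : H →L[ℂ] H} (hA : IsSelfAdjoint A) {f g : ℝ → ℝ}
    (hf : ContinuousOn f (spectrum ℝ A)) (hg : ContinuousOn g (spectrum ℝ A))
    (hfg : ∀ x ∈ spectrum ℝ A, g x = 0 → f x = 0) {v : H} (hv : cfc g A v = 0) :
    cfc f A v = 0 := by
  have hK : IsCompact (spectrum ℝ A) := ContinuousFunctionalCalculus.isCompact_spectrum A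
  -- Where `f² ≥ ε` the function `g` has no zero, and this part of the spectrum is compact, so
  -- `f²/g²` is bounded there by some `C`. Applied to `v` with `g(A)v = 0`, this yields `‖f(A)v‖² ≤
  -- ε‖v‖²` for every `ε`.
  have hbound : ∀ ε > 0, ∃ C : ℝ, ∀ x ∈ spectrum ℝ A, f x * f x ≤ ε + C * (g x * g x) := by
    intro ε hε
    have hK' : IsCompact (spectrum ℝ A ∩ (fun x => f x * f x) ⁻¹' Set.Ici ε) :=
      hK.of_isClosed_subset ((hf.mul hf).preimage_isClosed_of_isClosed hK.isClosed isClosed_Ici)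
        Set.inter_subset_left
    have hc : ContinuousOn (fun x => (f x * f x) / (g x * g x))
        (spectrum ℝ A ∩ (fun x => f x * f x) ⁻¹' Set.Ici ε) := by
      refine ((hf.mul hf).mono Set.inter_subset_left).div
        ((hg.mul hg).mono Set.inter_subset_left) fun x hx h0 => ?_
      have h1 := hfg x hx.1 (mul_self_eq_zero.1 h0)
      have h2 : ε ≤ f x * f x := hx.2
      rw [h1] at h2
      linarith
    obtain ⟨C, hC⟩ := hK'.bddAbove_image hc
    refine ⟨max C 0, fun x hx => ?_⟩
    by_cases hε' : ε ≤ f x * f x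
    · have h1 : (f x * f x) / (g x * g x) ≤ C := hC ⟨x, ⟨hx, hε'⟩, rfl⟩
      have hg0 : 0 < g x * g x := by
        refine lt_of_le_of_ne (mul_self_nonneg _) fun h0 => ?_
        rw [hfg x hx (mul_self_eq_zero.1 h0.symm)] at hε'
        linarith
      rw [div_le_iff₀ hg0] at h1
      have := mul_le_mul_of_nonneg_right (le_max_left C 0) hg0.le
      linarith
    · have := mul_nonneg (le_max_right C 0) (mul_self_nonneg (g x))
      linarith
  have hfs : IsSelfAdjoint (cfc f A) := cfc_predicate f A
  have hgs : IsSelfAdjoint (cfc g A) := cfc_predicate g A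
  have hle : ∀ ε > 0, ‖cfc f A v‖ ^ 2 ≤ ε * ‖v‖ ^ 2 := by
    intro ε hε
    obtain ⟨C, hC⟩ := hbound ε hε
    have h1 : cfc (fun x => f x * f x) A ≤ cfc (fun x => ε + C * (g x * g x)) A :=
      cfc_mono hC
    have h2 := re_inner_mono h1 v
    rw [cfc_mul f f A, cfc_const_add ε _ A, cfc_const_mul C _ A, cfc_mul g g A] at h2
    rw [norm_apply_sq_of_isSelfAdjoint hfs]
    refine h2.trans (le_of_eq ?_)
    have h3 : (cfc g A * cfc g A) v = 0 := by
      rw [mul_apply_eq_comp, hv, map_zero]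
    rw [add_apply, smul_apply, h3, smul_zero, add_zero, Algebra.algebraMap_eq_smul_one,
      smul_apply, one_apply_eq_self, inner_smul_right_eq_smul, RCLike.smul_re,
      inner_self_eq_norm_sq]
  have h0 : ‖cfc f A v‖ ^ 2 ≤ 0 := by
    refine le_of_forall_pos_le_add fun δ hδ => ?_
    have h1 := hle (δ / (‖v‖ ^ 2 + 1)) (by positivity)
    refine h1.trans ?_
    rw [zero_add, div_mul_eq_mul_div, div_le_iff₀ (by positivity)]
    nlinarith
  exact norm_eq_zero.1 (pow_eq_zero_iff two_ne_zero |>.1 (le_antisymm h0 (by positivity)))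

theorem spectrum_nonneg {A : H →L[ℂ] H} (hA : 0 ≤ A) {x : ℝ} (hx : x ∈ spectrum ℝ A) : 0 ≤ x :=
  spectrum_nonneg_of_nonneg hA hx

theorem cfc_sub_const_apply {A : H →L[ℂ] H} (hA : IsSelfAdjoint A) {f : ℝ → ℝ} (hf : Continuous f)
    (c : ℝ) (v : H) : cfc (fun x => f x - c) A v = cfc f A v - c • v := by
  rw [cfc_sub f (fun _ => c) A hf.continuousOn, cfc_const c A, Algebra.algebraMap_eq_smul_one,
    sub_apply, smul_apply, one_apply_eq_self]

/-- The zero of `x - c` is also a zero of `x ^ t - c ^ t`, so `cfc_apply_eq_zero` applies. -/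
theorem rpow_apply_eigenvector {A : H →L[ℂ] H} (hA : 0 ≤ A) {t : ℝ} (ht : 0 ≤ t) {c : ℝ} {v : H}
    (hv : A v = c • v) : (A ^ t) v = (c ^ t) • v := by
  have hsa : IsSelfAdjoint A := IsSelfAdjoint.of_nonneg hA
  have hcont : Continuous fun x : ℝ => x ^ t := Real.continuous_rpow_const ht
  have hg : cfc (fun x : ℝ => x - c) A v = 0 := by
    rw [cfc_sub_const_apply hsa continuous_id', cfc_id' ℝ A, hv, sub_self]
  have h := cfc_apply_eq_zero hsa (f := fun x => x ^ t - c ^ t) (by fun_prop) (by fun_prop)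
    (fun x _ hx => by rw [sub_eq_zero.1 hx, sub_self]) hg
  rw [cfc_sub_const_apply hsa hcont, sub_eq_zero, ← CFC.rpow_eq_cfc_real] at h
  exact h

/-- Bernoulli's inequality at `x / c - 1`, scaled by `c ^ t`: a convex power lies above its tangent
at `c`. -/
theorem tangent_le_rpow {c t x : ℝ} (hc : 0 < c) (ht : 1 ≤ t) (hx : 0 ≤ x) :
    (1 - t) * c ^ t + t * c ^ (t - 1) * x ≤ x ^ t := by
  have h := one_add_mul_self_le_rpow_one_add (s := x / c - 1)
    (by linarith [div_nonneg hx hc.le]) ht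
  have h1 : x ^ t = c ^ t * (1 + (x / c - 1)) ^ t := by
    rw [← Real.mul_rpow hc.le (by rw [add_sub_cancel]; positivity), add_sub_cancel,
      mul_div_cancel₀ _ hc.ne']
  rw [h1, Real.rpow_sub_one hc.ne']
  refine le_trans (le_of_eq ?_) (mul_le_mul_of_nonneg_left h (Real.rpow_nonneg hc.le t))
  field_simp
  ring

theorem rpow_le_tangent {c t x : ℝ} (hc : 0 < c) (ht : 0 ≤ t) (ht' : t ≤ 1) (hx : 0 ≤ x) :
    x ^ t ≤ (1 - t) * c ^ t + t * c ^ (t - 1) * x := by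
  have h := rpow_one_add_le_one_add_mul_self (s := x / c - 1)
    (by linarith [div_nonneg hx hc.le]) ht ht'
  have h1 : x ^ t = c ^ t * (1 + (x / c - 1)) ^ t := by
    rw [← Real.mul_rpow hc.le (by rw [add_sub_cancel]; positivity), add_sub_cancel,
      mul_div_cancel₀ _ hc.ne']
  rw [h1, Real.rpow_sub_one hc.ne']
  refine le_trans (mul_le_mul_of_nonneg_left h (Real.rpow_nonneg hc.le t)) (le_of_eq ?_)
  field_simp
  ring

theorem eq_of_tangent_eq_rpow {c t x : ℝ} (hc : 0 < c) (ht : 1 < t) (hx : 0 ≤ x)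
    (h : x ^ t = (1 - t) * c ^ t + t * c ^ (t - 1) * x) : x = c := by
  by_contra hne
  have hs : x / c - 1 ≠ 0 := by
    rw [sub_ne_zero, Ne, div_eq_one_iff_eq hc.ne']
    exact hne
  have h0 := one_add_mul_self_lt_rpow_one_add (s := x / c - 1)
    (by linarith [div_nonneg hx hc.le]) hs ht
  have h1 : x ^ t = c ^ t * (1 + (x / c - 1)) ^ t := by
    rw [← Real.mul_rpow hc.le (by rw [add_sub_cancel]; positivity), add_sub_cancel,
      mul_div_cancel₀ _ hc.ne']
  have h2 := mul_lt_mul_of_pos_left h0 (Real.rpow_pos_of_pos hc t)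
  rw [← h1, h, Real.rpow_sub_one hc.ne'] at h2
  refine h2.ne ?_
  field_simp
  ring

theorem cfc_affine_re_inner {A : H →L[ℂ] H} (hA : IsSelfAdjoint A) (a b : ℝ) {v : H}
    (hv : ‖v‖ = 1) :
    RCLike.re (inner ℂ v (cfc (fun x : ℝ => a + b * x) A v)) =
      a + b * RCLike.re (inner ℂ v (A v)) := by
  rw [cfc_const_add a _ A, cfc_const_mul b (fun x => x) A, cfc_id' ℝ A, add_apply, smul_apply,
    Algebra.algebraMap_eq_smul_one, smul_apply, one_apply_eq_self, inner_add_right,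
    inner_smul_right_eq_smul, inner_smul_right_eq_smul, map_add, RCLike.smul_re, RCLike.smul_re,
    inner_self_eq_norm_sq, hv]
  ring

/-- Jensen's inequality for the spectral distribution of `A` in the state `v`: bound the concave
power by its tangent at the mean, lift the bound to operators, and evaluate at `v`. -/
theorem re_inner_rpow_le {A : H →L[ℂ] H} (hA : 0 ≤ A) {t : ℝ} (ht : 0 < t) (ht' : t ≤ 1) {v : H}
    (hv : ‖v‖ = 1) :
    RCLike.re (inner ℂ v ((A ^ t) v)) ≤ RCLike.re (inner ℂ v (A v)) ^ t := by
  have hsa : IsSelfAdjoint A := IsSelfAdjoint.of_nonneg hA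
  have hcont : Continuous fun x : ℝ => x ^ t := Real.continuous_rpow_const ht.le
  set c := RCLike.re (inner ℂ v (A v)) with hc
  have key : ∀ d > 0, RCLike.re (inner ℂ v ((A ^ t) v)) ≤
      (1 - t) * d ^ t + t * d ^ (t - 1) * c := by
    intro d hd
    rw [← cfc_affine_re_inner hsa _ _ hv, CFC.rpow_eq_cfc_real]
    exact re_inner_mono
      (cfc_mono fun x hx => rpow_le_tangent hd ht.le ht' (spectrum_nonneg hA hx)) v
  rcases (re_inner_nonneg hA v).eq_or_lt with h0 | h0
  · rw [← hc] at h0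
    rw [← h0, Real.zero_rpow ht.ne']
    -- For mean zero the tangent may be vertical, so the tangency point `d > 0` is sent to `0`
    -- instead.
    have hlim : Filter.Tendsto (fun d : ℝ => (1 - t) * d ^ t) (nhdsWithin 0 (Set.Ioi 0))
        (nhds 0) := by
      have : Continuous fun d : ℝ => (1 - t) * d ^ t := by fun_prop
      have h1 := this.tendsto 0
      rw [Real.zero_rpow ht.ne', mul_zero] at h1
      exact h1.mono_left nhdsWithin_le_nhds
    refine ge_of_tendsto hlim ?_
    filter_upwards [self_mem_nhdsWithin] with d hd
    have := key d hd
    rwa [← h0, mul_zero, add_zero] at this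
  · refine (key c h0).trans (le_of_eq ?_)
    rw [Real.rpow_sub_one h0.ne']
    field_simp
    ring

theorem rpow_le_re_inner {A : H →L[ℂ] H} (hA : 0 ≤ A) {t : ℝ} (ht : 1 ≤ t) {v : H}
    (hv : ‖v‖ = 1) :
    RCLike.re (inner ℂ v (A v)) ^ t ≤ RCLike.re (inner ℂ v ((A ^ t) v)) := by
  have hsa : IsSelfAdjoint A := IsSelfAdjoint.of_nonneg hA
  have hcont : Continuous fun x : ℝ => x ^ t := Real.continuous_rpow_const (by linarith)
  set c := RCLike.re (inner ℂ v (A v)) with hc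
  rcases (re_inner_nonneg hA v).eq_or_lt with h0 | h0
  · rw [← hc] at h0
    rw [← h0, Real.zero_rpow (by linarith)]
    exact re_inner_nonneg CFC.rpow_nonneg v
  · have h1 : c ^ t = (1 - t) * c ^ t + t * c ^ (t - 1) * c := by
      rw [Real.rpow_sub_one h0.ne']
      field_simp
      ring
    have h2 := re_inner_mono (cfc_mono (f := fun x => (1 - t) * c ^ t + t * c ^ (t - 1) * x)
      (g := fun x => x ^ t) (fun x hx => tangent_le_rpow h0 ht (spectrum_nonneg hA hx))
      (by fun_prop) hcont.continuousOn) v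
    rw [cfc_affine_re_inner hsa _ _ hv, ← CFC.rpow_eq_cfc_real] at h2
    exact h1.trans_le h2

/-- By strict convexity the gap `g` between the power and its tangent at the mean `c` is nonnegative
on the spectrum and vanishes only at `c`. Equality gives `⟨v, g(A)v⟩ = 0`, hence `g(A)v = 0`, hence
`(A - c)v = 0`. -/
theorem eigenvector_of_rpow_eq_re_inner {A : H →L[ℂ] H} (hA : 0 ≤ A) {t : ℝ} (ht : 1 < t) {v : H}
    (hv : ‖v‖ = 1)
    (h : RCLike.re (inner ℂ v ((A ^ t) v)) = RCLike.re (inner ℂ v (A v)) ^ t) :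
    A v = RCLike.re (inner ℂ v (A v)) • v := by
  have hsa : IsSelfAdjoint A := IsSelfAdjoint.of_nonneg hA
  have hcont : Continuous fun x : ℝ => x ^ t := Real.continuous_rpow_const (by linarith)
  set c := RCLike.re (inner ℂ v (A v)) with hc
  rcases (re_inner_nonneg hA v).eq_or_lt with h0 | h0
  · rw [← hc] at h0
    rw [← h0, zero_smul]
    exact apply_eq_zero_of_re_inner_eq_zero hA (hc.symm.trans h0.symm)
  · set g : ℝ → ℝ := fun x => x ^ t - ((1 - t) * c ^ t + t * c ^ (t - 1) * x) with hg
    have hgc : Continuous g := by fun_prop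
    have hg0 : ∀ x ∈ spectrum ℝ A, 0 ≤ g x := fun x hx =>
      sub_nonneg.2 (tangent_le_rpow h0 ht.le (spectrum_nonneg hA hx))
    have hG : 0 ≤ cfc g A := cfc_nonneg hg0
    have hGv : RCLike.re (inner ℂ v (cfc g A v)) = 0 := by
      rw [hg, cfc_sub _ _ A, sub_apply, inner_sub_right, map_sub, cfc_affine_re_inner hsa _ _ hv,
        ← CFC.rpow_eq_cfc_real, h, ← hc, Real.rpow_sub_one h0.ne']
      field_simp
      ring
    have h3 : cfc g A v = 0 := apply_eq_zero_of_re_inner_eq_zero hG hGv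
    have h4 := cfc_apply_eq_zero hsa (f := fun x => x - c) (by fun_prop) hgc.continuousOn
      (fun x hx hx0 => sub_eq_zero.2
        (eq_of_tangent_eq_rpow h0 ht (spectrum_nonneg hA hx) (sub_eq_zero.1 hx0))) h3
    rw [cfc_sub_const_apply hsa continuous_id', cfc_id' ℝ A, sub_eq_zero] at h4
    exact h4

theorem rpow_add_of_pos {A : H →L[ℂ] H} {s t : ℝ} (hs : 0 < s) (ht : 0 < t) :
    A ^ (s + t) = A ^ s * A ^ t := by
  lift s to ℝ≥0 using hs.le
  lift t to ℝ≥0 using ht.le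
  have hs' : 0 < s := by exact_mod_cast hs
  have ht' : 0 < t := by exact_mod_cast ht
  rw [← NNReal.coe_add, ← CFC.nnrpow_eq_rpow hs', ← CFC.nnrpow_eq_rpow ht',
    ← CFC.nnrpow_eq_rpow (by positivity), CFC.nnrpow_add hs' ht']

theorem rpow_rpow_of_nonneg {A : H →L[ℂ] H} (hA : 0 ≤ A) {s t : ℝ} (hs : 0 ≤ s) (ht : 0 ≤ t) :
    (A ^ s) ^ t = A ^ (s * t) :=
  CFC.rpow_rpow_of_exponent_nonneg A s t hs ht hA

theorem smul_rpow {A : H →L[ℂ] H} (hA : 0 ≤ A) {c : ℝ} (hc : 0 < c) {t : ℝ} (ht : 0 ≤ t) :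
    (c • A) ^ t = (c ^ t) • A ^ t := by
  have hcA : 0 ≤ c • A := smul_nonneg hc.le hA
  have hcont : Continuous fun x : ℝ => x ^ t := Real.continuous_rpow_const ht
  rw [CFC.rpow_eq_cfc_real, CFC.rpow_eq_cfc_real,
    ← cfc_comp_smul c (fun x : ℝ => x ^ t) A hcont.continuousOn,
    ← cfc_smul (c ^ t) (fun x : ℝ => x ^ t) A]
  refine cfc_congr fun x hx => ?_
  change (c * x) ^ t = c ^ t * x ^ t
  rw [Real.mul_rpow hc.le (spectrum_nonneg hA hx)]

end FunctionalCalculus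

/-! ### Compactness from finiteness of the trace -/

section Compactness

variable {H : Type*} [NormedAddCommGroup H] [InnerProductSpace ℂ H] [CompleteSpace H]

/-- On the unit ball `‖K(x - y)‖² = ⟨x - y, K²(x - y)⟩ ≤ 2‖K²(x - y)‖`, so a fine net for the image
under `K²` yields one for the image under `K`. -/
theorem isCompactOperator_of_mul_self {K : H →L[ℂ] H} (hK : IsSelfAdjoint K)
    (h : IsCompactOperator (K * K)) : IsCompactOperator K := by
  refine (isCompactOperator_iff_isCompact_closure_image_closedBall (K : H →ₗ[ℂ] H)
    zero_lt_one).2 (TotallyBounded.closure ?_ |>.isCompact_of_isClosed isClosed_closure)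
  have htb : TotallyBounded ((K * K) '' Metric.closedBall 0 1) :=
    ((IsCompactOperator.isCompact_closure_image_closedBall (f := ((K * K : H →L[ℂ] H) : H →ₗ[ℂ] H))
      h 1).totallyBounded).subset subset_closure
  rw [Metric.totallyBounded_iff] at htb ⊢
  have hball : ∀ x ∈ Metric.closedBall (0 : H) 1, ∀ y ∈ Metric.closedBall (0 : H) 1,
      dist (K x) (K y) ^ 2 ≤ 2 * dist ((K * K) x) ((K * K) y) := by
    intro x hx y hy
    rw [dist_eq_norm, dist_eq_norm, ← map_sub, ← map_sub, norm_apply_sq_of_isSelfAdjoint hK]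
    rw [mem_closedBall_zero_iff] at hx hy
    refine (RCLike.re_le_norm _).trans ((norm_inner_le_norm _ _).trans ?_)
    refine mul_le_mul_of_nonneg_right ?_ (norm_nonneg _)
    linarith [norm_sub_le x y]
  intro ε hε
  -- Two points in a common ball of radius `ε²/8` are at distance below `ε²/4`, and `2 · ε²/4 < ε²`.
  -- The centres lie in the range of `K²` only approximately, so preimages `p y` of nearby points
  -- are chosen.
  obtain ⟨t, ht, hcov⟩ := htb (ε ^ 2 / 8) (by positivity)
  classical
  choose! p hp using fun (y : H) (hy : ∃ x ∈ Metric.closedBall (0 : H) 1,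
    (K * K) x ∈ Metric.ball y (ε ^ 2 / 8)) => hy
  refine ⟨(fun y => K (p y)) '' t, ht.image _, ?_⟩
  rintro _ ⟨x, hx, rfl⟩
  obtain ⟨y, hy, hxy⟩ := Set.mem_iUnion₂.1 (hcov ⟨x, hx, rfl⟩)
  obtain ⟨hp1, hp2⟩ := hp y ⟨x, hx, hxy⟩
  refine Set.mem_iUnion₂.2 ⟨K (p y), ⟨y, hy, rfl⟩, ?_⟩
  have h1 := hball x hx (p y) hp1
  have h2 := dist_triangle_right ((K * K) x) ((K * K) (p y)) y
  rw [Metric.mem_ball] at hxy hp2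
  change dist (K x) (K (p y)) < ε
  refine lt_of_pow_lt_pow_left₀ 2 hε.le ?_
  nlinarith

/-- Halving the exponent preserves compactness. Once `s / 2 ^ n < t`, the operator `A ^ t` is a
compact operator times a bounded one. -/
theorem isCompactOperator_rpow {A : H →L[ℂ] H} {s t : ℝ} (hs : 0 < s) (ht : 0 < t)
    (h : IsCompactOperator (A ^ s)) : IsCompactOperator (A ^ t) := by
  have key : ∀ n : ℕ, IsCompactOperator (A ^ (s * (1 / 2) ^ n)) := by
    intro n
    induction n with
    | zero => simpa using h
    | succ n ih =>
      refine isCompactOperator_of_mul_self (IsSelfAdjoint.of_nonneg CFC.rpow_nonneg) ?_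
      rw [← rpow_add_of_pos (by positivity) (by positivity)]
      convert ih using 3
      rw [pow_succ]
      ring
  obtain ⟨n, hn⟩ := exists_pow_lt_of_lt_one (show 0 < t / s by positivity)
    (show (1 / 2 : ℝ) < 1 by norm_num)
  rw [lt_div_iff₀ hs] at hn
  have h1 : A ^ t = A ^ (s * (1 / 2) ^ n) * A ^ (t - s * (1 / 2) ^ n) := by
    rw [← rpow_add_of_pos (by positivity) (by linarith), add_sub_cancel]
  rw [h1]
  exact (key n).comp_clm _

set_option linter.unusedSectionVars false in
theorem isCompactOperator_smulRight (φ : H →L[ℂ] ℂ) (v : H) :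
    IsCompactOperator (φ.smulRight v) := by
  have h1 : IsCompactOperator (ContinuousLinearMap.toSpanSingleton ℂ v) :=
    isCompactOperator_of_locallyCompactSpace_rng _
  exact h1.comp_clm φ

set_option linter.unusedSectionVars false in
theorem norm_sum_inner_smul_le {ι : Type*} {e : ι → H} (he : Orthonormal ℂ e) (v : ι → H) (x : H)
    (t : Finset ι) :
    ‖∑ i ∈ t, inner ℂ (e i) x • v i‖ ≤ ‖x‖ * √(∑ i ∈ t, ‖v i‖ ^ 2) := by
  calc ‖∑ i ∈ t, inner ℂ (e i) x • v i‖ ≤ ∑ i ∈ t, ‖inner ℂ (e i) x‖ * ‖v i‖ := by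
        refine (norm_sum_le _ _).trans (le_of_eq (Finset.sum_congr rfl fun i _ => norm_smul _ _))
    _ ≤ √(∑ i ∈ t, ‖inner ℂ (e i) x‖ ^ 2) * √(∑ i ∈ t, ‖v i‖ ^ 2) :=
        Real.sum_mul_le_sqrt_mul_sqrt _ _ _
    _ ≤ ‖x‖ * √(∑ i ∈ t, ‖v i‖ ^ 2) := by
        refine mul_le_mul_of_nonneg_right ?_ (Real.sqrt_nonneg _)
        exact (Real.sqrt_le_left (norm_nonneg _)).2 (he.sum_inner_products_le x)

/-- A Hilbert–Schmidt operator is the norm limit of its finite-rank truncations: by Cauchy–Schwarz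
and Bessel, the error is at most the square root of the tail of the series. -/
theorem isCompactOperator_of_summable_norm_sq {ι : Type*} (b : HilbertBasis ι ℂ H) {S : H →L[ℂ] H}
    (hS : Summable fun i => ‖S (b i)‖ ^ 2) : IsCompactOperator S := by
  classical
  let P : Finset ι → (H →L[ℂ] H) := fun s => ∑ i ∈ s, (innerSL ℂ (b i)).smulRight (S (b i))
  have hPapp : ∀ s x, P s x = ∑ i ∈ s, inner ℂ (b i) x • S (b i) := by
    intro s x
    simp [P]
  have hPc : ∀ s, IsCompactOperator (P s) := fun s =>
    Submodule.sum_mem (compactOperator (RingHom.id ℂ) H H) fun i _ =>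
      isCompactOperator_smulRight (innerSL ℂ (b i)) (S (b i))
  have hbound : ∀ s x, ‖(S - P s) x‖ ≤ √(∑' i : {i // i ∉ s}, ‖S (b i)‖ ^ 2) * ‖x‖ := by
    intro s x
    have h1 : HasSum (fun i => inner ℂ (b i) x • S (b i)) (S x) := by
      have := (b.hasSum_repr x).mapL S
      simpa [b.repr_apply_apply] using this
    have h2 : HasSum (fun i : {i // i ∉ s} => inner ℂ (b i) x • S (b i)) ((S - P s) x) := by
      have h3 := (s.hasSum_compl_iff (f := fun i => inner ℂ (b i) x • S (b i))
        (a := (S - P s) x)).2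
      apply h3
      rw [sub_apply, hPapp, sub_add_cancel]
      exact h1
    refine le_of_tendsto h2.norm (Filter.Eventually.of_forall fun t => ?_)
    rw [mul_comm]
    refine (norm_sum_inner_smul_le (b.orthonormal.comp _ Subtype.val_injective)
      (fun i : {i // i ∉ s} => S (b i)) x t).trans ?_
    refine mul_le_mul_of_nonneg_left (Real.sqrt_le_sqrt ?_) (norm_nonneg _)
    exact (hS.subtype _).sum_le_tsum t fun _ _ => by positivity
  have hlim : Filter.Tendsto (fun s : Finset ι => √(∑' i : {i // i ∉ s}, ‖S (b i)‖ ^ 2))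
      Filter.atTop (nhds 0) := by
    have := (Real.continuous_sqrt.tendsto 0).comp
      (tendsto_tsum_compl_atTop_zero fun i => ‖S (b i)‖ ^ 2)
    rwa [Real.sqrt_zero] at this
  refine isCompactOperator_of_tendsto (l := Filter.atTop) (F := P) ?_
    (Filter.Eventually.of_forall hPc)
  rw [tendsto_iff_norm_sub_tendsto_zero]
  refine squeeze_zero (fun _ => norm_nonneg _) (fun s => ?_) hlim
  rw [norm_sub_rev]
  exact ContinuousLinearMap.opNorm_le_bound _ (Real.sqrt_nonneg _) (hbound s)

/-- The trace of `A` is the squared Hilbert–Schmidt norm of `√A`. -/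
theorem isCompactOperator_of_trace_lt_top {A : H →L[ℂ] H} (hA : 0 ≤ A) (h : trace A < ⊤) :
    IsCompactOperator A := by
  obtain ⟨w, b, -⟩ := exists_hilbertBasis ℂ H
  rw [trace_eq_tsum b hA, tsum_basis_eq b b hA] at h
  have hS : Summable fun i => ‖CFC.sqrt A (b i)‖ ^ 2 := by
    have h1 := ENNReal.summable_toReal h.ne
    refine h1.congr fun i => ?_
    rw [ENNReal.toReal_ofReal (by positivity)]
  have h1 := isCompactOperator_of_summable_norm_sq b hS
  rw [← CFC.sqrt_mul_sqrt_self A hA]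
  exact h1.comp_clm _

theorem isCompactOperator_of_trace_rpow_lt_top {A : H →L[ℂ] H} (hA : 0 ≤ A) {s : ℝ} (hs : 0 < s)
    (h : trace (A ^ s) < ⊤) : IsCompactOperator A := by
  have h1 := isCompactOperator_rpow hs one_pos
    (isCompactOperator_of_trace_lt_top CFC.rpow_nonneg h)
  rwa [CFC.rpow_one A hA] at h1

set_option linter.unusedSectionVars false in
theorem inner_eq_zero_of_hilbertBasis {ι : Type*} {E : Submodule ℂ H} (b : HilbertBasis ι ℂ E)
    {x : H} (hx : ∀ i, inner ℂ (b i : H) x = 0) {u : H} (hu : u ∈ E) : inner ℂ u x = 0 := by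
  have h1 := ((b.hasSum_repr ⟨u, hu⟩).mapL E.subtypeL).mapL (innerSL ℂ x)
  have h2 : ∀ i, innerSL ℂ x (E.subtypeL (b.repr ⟨u, hu⟩ i • b i)) = 0 := by
    intro i
    rw [map_smul, map_smul]
    refine (congrArg (b.repr ⟨u, hu⟩ i • ·) ?_).trans (smul_zero _)
    exact inner_eq_zero_symm.1 (hx i)
  simp_rw [h2] at h1
  rw [inner_eq_zero_symm]
  exact h1.unique hasSum_zero

end Compactness

/-! ### Orthonormal eigenbases of compact operators -/

section SpectralTheorem

universe u
variable {H : Type u} [NormedAddCommGroup H] [InnerProductSpace ℂ H] [CompleteSpace H]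

set_option linter.unusedSectionVars false in
theorem isClosed_eigenspace (A : H →L[ℂ] H) (μ : ℂ) :
    IsClosed (Module.End.eigenspace (A : Module.End ℂ H) μ : Set H) := by
  have : (Module.End.eigenspace (A : Module.End ℂ H) μ : Set H) = {x | A x = μ • x} := by
    ext x
    exact Module.End.mem_eigenspace_iff
  rw [this]
  exact isClosed_eq A.continuous (continuous_const_smul μ)

/-- The eigenspaces, the kernel included, are mutually orthogonal with trivial joint complement, so
Hilbert bases of all of them together form one of `H`. -/
theorem exists_complex_eigenbasis {A : H →L[ℂ] H} (hA : IsSelfAdjoint A)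
    (hc : IsCompactOperator A) :
    ∃ (ι : Type u) (f : HilbertBasis ι ℂ H) (c : ι → ℂ), ∀ i, A (f i) = c i • f i := by
  have hsym : A.IsSymmetric := hA.isSymmetric
  have hcomp : ∀ μ, CompleteSpace (Module.End.eigenspace (A : Module.End ℂ H) μ) :=
    fun μ => (isClosed_eigenspace A μ).completeSpace_coe
  choose w b hb using fun μ => exists_hilbertBasis ℂ (Module.End.eigenspace (A : Module.End ℂ H) μ)
  let e : (Σ μ, w μ) → H := fun a => (b a.1 a.2 : H)
  have horth : Orthonormal ℂ e :=
    hsym.orthogonalFamily_eigenspaces.orthonormal_sigma_orthonormal fun μ => (b μ).orthonormal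
  have hbot : (Submodule.span ℂ (Set.range e))ᗮ = ⊥ := by
    rw [eq_bot_iff, ← ContinuousLinearMap.orthogonalComplement_iSup_eigenspaces_eq_bot hc hsym,
      ← Submodule.iInf_orthogonal]
    intro x hx
    rw [Submodule.mem_iInf]
    intro μ
    rw [Submodule.mem_orthogonal]
    intro u hu
    refine inner_eq_zero_of_hilbertBasis (b μ) (fun i => ?_) hu
    exact (Submodule.mem_orthogonal _ _).1 hx _ (Submodule.subset_span ⟨⟨μ, i⟩, rfl⟩)
  refine ⟨Σ μ, w μ, HilbertBasis.mkOfOrthogonalEqBot horth hbot, fun a => a.1, fun a => ?_⟩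
  rw [HilbertBasis.coe_mkOfOrthogonalEqBot]
  exact Module.End.mem_eigenspace_iff.1 (b a.1 a.2).2

/-- A compact positive operator is diagonal in some Hilbert basis. -/
theorem exists_eigenbasis {A : H →L[ℂ] H} (hA : 0 ≤ A) (hc : IsCompactOperator A) :
    ∃ (ι : Type u) (f : HilbertBasis ι ℂ H) (c : ι → ℝ), (∀ i, 0 ≤ c i) ∧
      ∀ i, A (f i) = c i • f i := by
  obtain ⟨ι, f, c, hf⟩ := exists_complex_eigenbasis (IsSelfAdjoint.of_nonneg hA) hc
  refine ⟨ι, f, fun i => RCLike.re (inner ℂ (f i) (A (f i))), fun i => re_inner_nonneg hA _,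
    fun i => ?_⟩
  have h2 : inner ℂ (f i) (A (f i)) = c i := by
    rw [hf, inner_smul_right, inner_self_eq_norm_sq_to_K, f.orthonormal.1 i]
    simp
  have h3 : ((RCLike.re (inner ℂ (f i) (A (f i))) : ℝ) : ℂ) = inner ℂ (f i) (A (f i)) :=
    (IsSelfAdjoint.of_nonneg hA).isSymmetric.coe_re_inner_self_apply (f i)
  rw [RCLike.real_smul_eq_coe_smul (K := ℂ)]
  exact (hf i).trans (by rw [← h2, ← h3]; rfl)

end SpectralTheorem

/-! ### Traces of powers and singular values -/

section Trace

universe u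
variable {H : Type u} [NormedAddCommGroup H] [InnerProductSpace ℂ H] [CompleteSpace H]

/-- An orthonormal family bounds the trace of a positive operator from below. -/
theorem tsum_le_trace {ι : Type*} {h : ι → H} (hh : Orthonormal ℂ h) {A : H →L[ℂ] H} (hA : 0 ≤ A) :
    ∑' i, ENNReal.ofReal (RCLike.re (inner ℂ (h i) (A (h i)))) ≤ trace A := by
  obtain ⟨w, b, hw, hb⟩ := hh.toSubtypeRange.exists_hilbertBasis_extension
  rw [trace_eq_tsum b hA, hb]
  let φ : ι → w := fun i => ⟨h i, hw ⟨i, rfl⟩⟩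
  have hφ : Function.Injective φ := fun i j hij =>
    hh.linearIndependent.injective (congrArg Subtype.val hij)
  exact ENNReal.tsum_comp_le_tsum_of_injective hφ
    fun x : w => ENNReal.ofReal (RCLike.re (inner ℂ (x : H) (A (x : H))))

set_option linter.unusedSectionVars false in
theorem ext_hilbertBasis {ι : Type*} (b : HilbertBasis ι ℂ H) {A B : H →L[ℂ] H}
    (h : ∀ i, A (b i) = B (b i)) : A = B := by
  refine ContinuousLinearMap.ext_on
    (Submodule.dense_iff_topologicalClosure_eq_top.2 b.dense_span) ?_
  rintro _ ⟨i, rfl⟩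
  exact h i

theorem eq_zero_of_trace_eq_zero {A : H →L[ℂ] H} (hA : 0 ≤ A) (h : trace A = 0) : A = 0 := by
  obtain ⟨w, b, -⟩ := exists_hilbertBasis ℂ H
  rw [trace_eq_tsum b hA, tsum_basis_eq b b hA, ENNReal.tsum_eq_zero] at h
  have h1 : ∀ i, CFC.sqrt A (b i) = 0 := by
    intro i
    have := h i
    rw [ENNReal.ofReal_eq_zero] at this
    have h2 : ‖CFC.sqrt A (b i)‖ ^ 2 = 0 := le_antisymm this (by positivity)
    simpa using h2
  have h2 : CFC.sqrt A = 0 := ext_hilbertBasis b h1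
  rw [← CFC.sqrt_mul_sqrt_self A hA, h2, zero_mul]

theorem trace_smul {A : H →L[ℂ] H} {c : ℝ} (hc : 0 ≤ c) :
    trace (c • A) = ENNReal.ofReal c * trace A := by
  unfold trace
  rw [← ENNReal.tsum_mul_left]
  refine tsum_congr fun i => ?_
  rw [smul_apply, inner_smul_right_eq_smul, RCLike.smul_re, ENNReal.ofReal_mul hc]

theorem mul_self_rpow {b : H →L[ℂ] H} (hb : 0 ≤ b) {q : ℝ} (hq : 0 < q) :
    (b * b) ^ (q / 2) = b ^ q := by
  have h1 : b * b = b ^ (2 : ℝ) := by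
    rw [show (2 : ℝ) = 1 + 1 by norm_num, rpow_add_of_pos one_pos one_pos, CFC.rpow_one b hb]
  rw [h1, rpow_rpow_of_nonneg hb two_pos.le (by positivity)]
  congr 1
  ring

/-- Singular vectors `g i`, `h i` and singular values `x i` of a compact operator. -/
theorem exists_singular_system {X : H →L[ℂ] H} (hX : IsCompactOperator (star X * X)) :
    ∃ (ι : Type u) (g : HilbertBasis ι ℂ H) (x : ι → ℝ) (h : ι → H), (∀ i, 0 ≤ x i) ∧
      (∀ i, X (g i) = x i • h i) ∧ (∀ i, star X (h i) = x i • g i) ∧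
      Orthonormal ℂ fun i : {i // x i ≠ 0} => h i := by
  obtain ⟨ι, g, c, hc, hg⟩ := exists_eigenbasis (star_mul_self_nonneg X) hX
  have hinner : ∀ i j, inner ℂ (X (g i)) (X (g j)) = c j • inner ℂ (g i) (g j) := by
    intro i j
    rw [← inner_smul_right_eq_smul, ← hg, mul_apply_eq_comp, ContinuousLinearMap.star_eq_adjoint,
      ContinuousLinearMap.adjoint_inner_right]
  have hz : ∀ i, √(c i) = 0 → X (g i) = 0 := by
    intro i hi
    rw [Real.sqrt_eq_zero (hc i)] at hi
    have := hinner i i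
    rwa [hi, zero_smul, inner_self_eq_zero] at this
  -- The `h i` are the normalised images `X (g i)`; the convention `0⁻¹ = 0` makes `h i = 0` at zero
  -- singular values, hence orthonormality only over the others.
  refine ⟨ι, g, fun i => √(c i), fun i => (√(c i))⁻¹ • X (g i), fun i => Real.sqrt_nonneg _,
    fun i => ?_, fun i => ?_, ?_⟩
  · by_cases hi : √(c i) = 0
    · dsimp only
      rw [hz i hi, smul_zero, smul_zero]
    · rw [smul_smul, mul_inv_cancel₀ hi, one_smul]
  · by_cases hi : √(c i) = 0
    · dsimp only
      rw [hi, inv_zero, zero_smul, zero_smul, map_zero]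
    · have h1 : star X (X (g i)) = c i • g i := hg i
      have h2 : star X ((√(c i))⁻¹ • X (g i)) = (√(c i))⁻¹ • star X (X (g i)) :=
        (star X).map_smul_of_tower _ _
      rw [h2, h1, smul_smul]
      congr 1
      rw [inv_mul_eq_iff_eq_mul₀ hi, Real.mul_self_sqrt (hc i)]
  · classical
    rw [orthonormal_iff_ite]
    rintro ⟨i, hi⟩ ⟨j, hj⟩
    rw [inner_smul_left_eq_star_smul, inner_smul_right_eq_smul, hinner,
      orthonormal_iff_ite.1 g.orthonormal]
    by_cases hij : i = j
    · subst hij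
      rw [if_pos rfl, if_pos rfl, smul_smul, smul_smul, starRingEnd_apply, star_trivial]
      have : (√(c i))⁻¹ * (√(c i))⁻¹ * c i = 1 := by
        nth_rw 3 [← Real.mul_self_sqrt (hc i)]
        have : √(c i) ≠ 0 := hi
        field_simp
      rw [this, one_smul]
    · rw [if_neg hij, if_neg (fun h => hij (congrArg Subtype.val h)), smul_zero, smul_zero, smul_zero]

theorem trace_rpow_eq_tsum {ι : Type*} (g : HilbertBasis ι ℂ H) {A : H →L[ℂ] H} (hA : 0 ≤ A)
    {c : ι → ℝ} (hg : ∀ i, A (g i) = c i • g i) {t : ℝ} (ht : 0 ≤ t) :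
    trace (A ^ t) = ∑' i, ENNReal.ofReal (c i ^ t) := by
  rw [trace_eq_tsum g CFC.rpow_nonneg]
  refine tsum_congr fun i => ?_
  rw [rpow_apply_eigenvector hA ht (hg i), inner_smul_right_eq_smul, RCLike.smul_re,
    inner_self_eq_norm_sq, g.orthonormal.1 i]
  simp

/-- The nonzero eigenvalues of `X*X` are eigenvalues of `XX*` on the orthonormal system `h i`. That
system need not be complete, so only an inequality results; the reverse one comes from exchanging
`X` and `X*`. -/
theorem trace_star_mul_self_rpow_le {X : H →L[ℂ] H} (hX : IsCompactOperator (star X * X)) {t : ℝ}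
    (ht : 0 < t) : trace ((star X * X) ^ t) ≤ trace ((X * star X) ^ t) := by
  obtain ⟨ι, g, x, h, hx, hXg, hXh, hh⟩ := exists_singular_system hX
  have hsm : ∀ (Y : H →L[ℂ] H) (c : ℝ) (v : H), Y (c • v) = c • Y v :=
    fun Y c v => Y.map_smul_of_tower c v
  have h1 : ∀ i, (star X * X) (g i) = (x i * x i) • g i := by
    intro i
    rw [mul_apply_eq_comp, hXg, hsm, hXh, smul_smul]
  have h2 : ∀ i, (X * star X) (h i) = (x i * x i) • h i := by
    intro i
    rw [mul_apply_eq_comp, hXh, hsm, hXg, smul_smul]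
  rw [trace_rpow_eq_tsum g (star_mul_self_nonneg X) h1 ht.le]
  refine le_trans (le_of_eq ?_) (tsum_le_trace hh CFC.rpow_nonneg)
  rw [← tsum_subtype_eq_of_support_subset (s := {i | x i ≠ 0})]
  · refine tsum_congr fun i => ?_
    rw [rpow_apply_eigenvector (mul_star_self_nonneg X) ht.le (h2 i), inner_smul_right_eq_smul,
      RCLike.smul_re, inner_self_eq_norm_sq, hh.1 i]
    simp
  · intro i hi hi0
    refine hi ?_
    dsimp only
    rw [hi0, mul_zero, Real.zero_rpow ht.ne', ENNReal.ofReal_zero]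

end Trace

/-! ### Scalar Young inequality and termwise equality in series -/

section Young

/-- Weighted AM–GM for `x ^ p` and `y ^ q` with weights `r / p` and `r / q`, whose sum is `1`. -/
theorem young_rpow {p q r x y : ℝ} (hp : 0 < p) (hq : 0 < q) (hr : 0 < r) (h : r⁻¹ = p⁻¹ + q⁻¹)
    (hx : 0 ≤ x) (hy : 0 ≤ y) : r⁻¹ * (x * y) ^ r ≤ p⁻¹ * x ^ p + q⁻¹ * y ^ q := by
  have hw : r / p + r / q = 1 := by
    rw [div_eq_mul_inv, div_eq_mul_inv, ← mul_add, ← h, mul_inv_cancel₀ hr.ne']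
  have h1 := Real.geom_mean_le_arith_mean2_weighted (div_nonneg hr.le hp.le)
    (div_nonneg hr.le hq.le) (Real.rpow_nonneg hx p) (Real.rpow_nonneg hy q) hw
  rw [← Real.rpow_mul hx, ← Real.rpow_mul hy, mul_div_cancel₀ _ hp.ne', mul_div_cancel₀ _ hq.ne',
    ← Real.mul_rpow hx hy] at h1
  refine (mul_le_mul_of_nonneg_left h1 (inv_nonneg.2 hr.le)).trans (le_of_eq ?_)
  field_simp

theorem eq_of_young_rpow_eq {p q r x y : ℝ} (hp : 0 < p) (hq : 0 < q) (hr : 0 < r)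
    (h : r⁻¹ = p⁻¹ + q⁻¹) (hx : 0 ≤ x) (hy : 0 ≤ y)
    (heq : r⁻¹ * (x * y) ^ r = p⁻¹ * x ^ p + q⁻¹ * y ^ q) : x ^ p = y ^ q := by
  have hw : r / p + r / q = 1 := by
    rw [div_eq_mul_inv, div_eq_mul_inv, ← mul_add, ← h, mul_inv_cancel₀ hr.ne']
  have h1 := Real.geom_mean_eq_arith_mean2_weighted_iff_of_pos (div_pos hr hp)
    (div_pos hr hq) (Real.rpow_nonneg hx p) (Real.rpow_nonneg hy q) hw
  rw [← Real.rpow_mul hx, ← Real.rpow_mul hy, mul_div_cancel₀ _ hp.ne', mul_div_cancel₀ _ hq.ne',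
    ← Real.mul_rpow hx hy] at h1
  refine h1.1 ?_
  have h2 : (x * y) ^ r = r * (r⁻¹ * (x * y) ^ r) := by field_simp
  rw [h2, heq]
  field_simp

theorem tsum_ofReal_add_le {ι : Type*} {u v w : ι → ℝ} {a b c : ℝ} (ha : 0 ≤ a) (hb : 0 ≤ b)
    (hc : 0 ≤ c) (hv : ∀ i, 0 ≤ v i) (hw : ∀ i, 0 ≤ w i)
    (h : ∀ i, a * u i ≤ b * v i + c * w i) :
    ENNReal.ofReal a * ∑' i, ENNReal.ofReal (u i) ≤
      ENNReal.ofReal b * ∑' i, ENNReal.ofReal (v i) +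
        ENNReal.ofReal c * ∑' i, ENNReal.ofReal (w i) := by
  rw [← ENNReal.tsum_mul_left, ← ENNReal.tsum_mul_left, ← ENNReal.tsum_mul_left,
    ← ENNReal.tsum_add]
  refine ENNReal.tsum_le_tsum fun i => ?_
  rw [← ENNReal.ofReal_mul ha, ← ENNReal.ofReal_mul hb, ← ENNReal.ofReal_mul hc,
    ← ENNReal.ofReal_add (mul_nonneg hb (hv i)) (mul_nonneg hc (hw i))]
  exact ENNReal.ofReal_le_ofReal (h i)

theorem eq_of_tsum_eq_of_le {ι : Type*} {u v : ι → ℝ≥0∞} (h : ∀ i, u i ≤ v i)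
    (heq : ∑' i, u i = ∑' i, v i) (hfin : ∑' i, u i ≠ ⊤) (i : ι) : u i = v i := by
  by_contra hne
  exact (ENNReal.tsum_lt_tsum hfin h (lt_of_le_of_ne (h i) hne)).ne heq

theorem eq_of_tsum_ofReal_add_eq {ι : Type*} {u v w : ι → ℝ} {a b c : ℝ} (ha : 0 ≤ a) (hb : 0 ≤ b)
    (hc : 0 ≤ c) (hu : ∀ i, 0 ≤ u i) (hv : ∀ i, 0 ≤ v i) (hw : ∀ i, 0 ≤ w i)
    (h : ∀ i, a * u i ≤ b * v i + c * w i)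
    (heq : ENNReal.ofReal a * ∑' i, ENNReal.ofReal (u i) =
      ENNReal.ofReal b * ∑' i, ENNReal.ofReal (v i) +
        ENNReal.ofReal c * ∑' i, ENNReal.ofReal (w i))
    (hfin : ENNReal.ofReal a * ∑' i, ENNReal.ofReal (u i) ≠ ⊤) (i : ι) :
    a * u i = b * v i + c * w i := by
  rw [← ENNReal.tsum_mul_left] at hfin
  rw [← ENNReal.tsum_mul_left, ← ENNReal.tsum_mul_left, ← ENNReal.tsum_mul_left,
    ← ENNReal.tsum_add] at heq
  have h1 : ∀ i, ENNReal.ofReal b * ENNReal.ofReal (v i) + ENNReal.ofReal c * ENNReal.ofReal (w i)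
      = ENNReal.ofReal (b * v i + c * w i) := fun i => by
    rw [← ENNReal.ofReal_mul hb, ← ENNReal.ofReal_mul hc,
      ← ENNReal.ofReal_add (mul_nonneg hb (hv i)) (mul_nonneg hc (hw i))]
  have h2 := eq_of_tsum_eq_of_le (fun i => by
    rw [h1, ← ENNReal.ofReal_mul ha]
    exact ENNReal.ofReal_le_ofReal (h i)) heq hfin i
  rw [h1, ← ENNReal.ofReal_mul ha] at h2
  exact (ENNReal.ofReal_eq_ofReal_iff (mul_nonneg ha (hu i))
    (add_nonneg (mul_nonneg hb (hv i)) (mul_nonneg hc (hw i)))).1 h2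

end Young

/-! ### Young's inequality for Schatten quasi-norms -/

section Hoelder

universe u
variable {H : Type u} [NormedAddCommGroup H] [InnerProductSpace ℂ H] [CompleteSpace H]

/-- `r⁻¹ ‖X‖_r ^ r`, where `‖X‖_r` is the Schatten (quasi-)norm. -/
noncomputable def schattenSum (r : ℝ) (X : H →L[ℂ] H) : ℝ≥0∞ :=
  ENNReal.ofReal r⁻¹ * trace ((X * star X) ^ (r / 2))

theorem re_inner_rpow_nonneg (A : H →L[ℂ] H) (t : ℝ) (v : H) :
    0 ≤ RCLike.re (inner ℂ v ((A ^ t) v)) :=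
  re_inner_nonneg (A := A ^ t) CFC.rpow_nonneg v

theorem trace_rpow_eq_tsum_inner {ι : Type*} (b : HilbertBasis ι ℂ H) (A : H →L[ℂ] H) (t : ℝ) :
    trace (A ^ t) = ∑' i, ENNReal.ofReal (RCLike.re (inner ℂ (b i) ((A ^ t) (b i)))) :=
  trace_eq_tsum b (A := A ^ t) CFC.rpow_nonneg

theorem schattenSum_of_nonneg {a : H →L[ℂ] H} (ha : 0 ≤ a) {p : ℝ} (hp : 0 < p) :
    schattenSum p a = ENNReal.ofReal p⁻¹ * trace (a ^ p) := by
  rw [schattenSum, (IsSelfAdjoint.of_nonneg ha).star_eq, mul_self_rpow ha hp]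

set_option linter.unusedSectionVars false in
theorem isCompactOperator_mul_left {X : H →L[ℂ] H} (hX : IsCompactOperator X) (Y : H →L[ℂ] H) :
    IsCompactOperator (Y * X) :=
  hX.clm_comp Y

theorem schattenSum_le_star {X : H →L[ℂ] H} (hX : IsCompactOperator X) {r : ℝ} (hr : 0 < r) :
    schattenSum r X ≤ schattenSum r (star X) := by
  have hc : IsCompactOperator (star (star X) * star X) := by
    rw [star_star]
    exact hX.comp_clm _
  have := trace_star_mul_self_rpow_le hc (t := r / 2) (by positivity)
  rw [star_star] at this
  rw [schattenSum, schattenSum, star_star]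
  gcongr

theorem schattenSum_star_le {X : H →L[ℂ] H} (hX : IsCompactOperator X) {r : ℝ} (hr : 0 < r) :
    schattenSum r (star X) ≤ schattenSum r X := by
  have hc : IsCompactOperator (star X * X) := isCompactOperator_mul_left hX _
  have := trace_star_mul_self_rpow_le hc (t := r / 2) (by positivity)
  rw [schattenSum, schattenSum, star_star]
  gcongr

theorem re_inner_mul_self {b : H →L[ℂ] H} (hb : 0 ≤ b) (v : H) :
    RCLike.re (inner ℂ v ((b * b) v)) = ‖b v‖ ^ 2 :=
  (norm_apply_sq_of_isSelfAdjoint (IsSelfAdjoint.of_nonneg hb) v).symm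

theorem sq_rpow_half {x : ℝ} (hx : 0 ≤ x) (q : ℝ) : (x ^ 2) ^ (q / 2) = x ^ q := by
  rw [← Real.rpow_natCast, ← Real.rpow_mul hx]
  congr 1
  push_cast
  ring

/-- Jensen for `b²` with exponent `q / 2 ≥ 1`, as `‖b v‖² = ⟨v, b² v⟩`. -/
theorem norm_rpow_le_re_inner {b : H →L[ℂ] H} (hb : 0 ≤ b) {q : ℝ} (hq : 2 ≤ q) {v : H}
    (hv : ‖v‖ = 1) : ‖b v‖ ^ q ≤ RCLike.re (inner ℂ v ((b ^ q) v)) := by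
  have h0 : 0 ≤ b * b := by
    nth_rw 1 [← (IsSelfAdjoint.of_nonneg hb).star_eq]
    exact star_mul_self_nonneg b
  have h1 := rpow_le_re_inner h0 (t := q / 2) (by linarith) hv
  rwa [re_inner_mul_self hb, sq_rpow_half (norm_nonneg _), mul_self_rpow hb (by linarith)] at h1

theorem eigenvector_of_norm_rpow_eq {b : H →L[ℂ] H} (hb : 0 ≤ b) {q : ℝ} (hq : 2 < q) {v : H}
    (hv : ‖v‖ = 1) (h : RCLike.re (inner ℂ v ((b ^ q) v)) = ‖b v‖ ^ q) : b v = ‖b v‖ • v := by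
  have h0 : 0 ≤ b * b := by
    nth_rw 1 [← (IsSelfAdjoint.of_nonneg hb).star_eq]
    exact star_mul_self_nonneg b
  have h1 := eigenvector_of_rpow_eq_re_inner h0 (t := q / 2) (by linarith) hv
  rw [re_inner_mul_self hb, sq_rpow_half (norm_nonneg _), mul_self_rpow hb (by linarith)] at h1
  -- Equality in Jensen gives `b² v = ‖b v‖² v`; taking the square root of `b²` turns this into the
  -- claim.
  have h2 := rpow_apply_eigenvector h0 (t := 1 / 2) (by norm_num) (h1 h)
  rwa [mul_self_rpow hb one_pos, sq_rpow_half (norm_nonneg _), CFC.rpow_one b hb,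
    Real.rpow_one] at h2

theorem mul_star_mul_of_nonneg {a b : H →L[ℂ] H} (ha : 0 ≤ a) (hb : 0 ≤ b) :
    (a * b) * star (a * b) = a * (b * b) * a := by
  rw [star_mul, (IsSelfAdjoint.of_nonneg ha).star_eq, (IsSelfAdjoint.of_nonneg hb).star_eq]
  simp only [mul_assoc]

/-- Jensen with exponent `r / 2 ≤ 1`; since `f` is an eigenvector of `a`, the mean is `⟨f, a b² a f⟩
= (c‖b f‖)²`. -/
theorem re_inner_mul_star_mul_rpow_le {a b : H →L[ℂ] H} (ha : 0 ≤ a) (hb : 0 ≤ b) {r : ℝ}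
    (hr : 0 < r) (hr' : r ≤ 2) {c : ℝ} (hc : 0 ≤ c) {f : H} (hf : ‖f‖ = 1) (haf : a f = c • f) :
    RCLike.re (inner ℂ f ((((a * b) * star (a * b)) ^ (r / 2)) f)) ≤ (c * ‖b f‖) ^ r := by
  have h1 := re_inner_rpow_le (mul_star_self_nonneg (a * b)) (t := r / 2) (by positivity)
    (by linarith) hf
  refine h1.trans (le_of_eq ?_)
  have h2 : RCLike.re (inner ℂ f ((a * b * star (a * b)) f)) = (c * ‖b f‖) ^ 2 := by
    rw [mul_star_mul_of_nonneg ha hb, mul_apply_eq_comp, haf, mul_apply_eq_comp]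
    have h3 := (IsSelfAdjoint.of_nonneg ha).isSymmetric f ((b * b) (c • f))
    have h4 : (b * b) (c • f) = c • (b * b) f := (b * b).map_smul_of_tower _ _
    refine (congrArg RCLike.re h3.symm).trans ?_
    change RCLike.re (inner ℂ (a f) _) = _
    rw [haf, h4, inner_smul_left_eq_star_smul, inner_smul_right_eq_smul, RCLike.smul_re,
      starRingEnd_apply, star_trivial, RCLike.smul_re, re_inner_mul_self hb]
    ring
  rw [h2, sq_rpow_half (mul_nonneg hc (norm_nonneg _))]

/-- Concave Jensen, scalar Young for `c` and `‖b f‖`, then convex Jensen. Overall equality forces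
equality in the last two: `c ^ p = ‖b f‖ ^ q`, and `f` is an eigenvector of `b`, so both powers act
on `f` by the same scalar. -/
theorem young_eigenvector {a b : H →L[ℂ] H} (ha : 0 ≤ a) (hb : 0 ≤ b) {p q r : ℝ}
    (hp : 0 < p) (hq : 2 < q) (hr : 0 < r) (hr' : r ≤ 2) (h : r⁻¹ = p⁻¹ + q⁻¹) {c : ℝ}
    (hc : 0 ≤ c) {f : H} (hf : ‖f‖ = 1) (haf : a f = c • f) :
    r⁻¹ * RCLike.re (inner ℂ f ((((a * b) * star (a * b)) ^ (r / 2)) f)) ≤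
        p⁻¹ * c ^ p + q⁻¹ * RCLike.re (inner ℂ f ((b ^ q) f)) ∧
      (r⁻¹ * RCLike.re (inner ℂ f ((((a * b) * star (a * b)) ^ (r / 2)) f)) =
        p⁻¹ * c ^ p + q⁻¹ * RCLike.re (inner ℂ f ((b ^ q) f)) → (a ^ p) f = (b ^ q) f) := by
  have hq0 : 0 < q := by linarith
  have hy := young_rpow hp hq0 hr h hc (norm_nonneg (b f))
  have h1 := mul_le_mul_of_nonneg_left (re_inner_mul_star_mul_rpow_le ha hb hr hr' hc hf haf)
    (inv_nonneg.2 hr.le)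
  have h2 := mul_le_mul_of_nonneg_left (norm_rpow_le_re_inner hb hq.le hf) (inv_nonneg.2 hq0.le)
  refine ⟨by linarith, fun heq => ?_⟩
  have h4 := eq_of_young_rpow_eq hp hq0 hr h hc (norm_nonneg (b f))
    (le_antisymm hy (by linarith))
  have h5 : RCLike.re (inner ℂ f ((b ^ q) f)) = ‖b f‖ ^ q :=
    mul_left_cancel₀ (inv_ne_zero hq0.ne') (by linarith)
  rw [rpow_apply_eigenvector ha hp.le haf,
    rpow_apply_eigenvector hb hq0.le (eigenvector_of_norm_rpow_eq hb hq hf h5), h4]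

/-- Young's inequality for Schatten norms, with indices `r ≤ 2 < q`. -/
theorem schattenSum_mul_le_of_two_lt {a b : H →L[ℂ] H} (ha : 0 ≤ a) (hb : 0 ≤ b) {p q r : ℝ}
    (hp : 0 < p) (hq : 2 < q) (hr : 0 < r) (hr' : r ≤ 2) (h : r⁻¹ = p⁻¹ + q⁻¹)
    (hac : IsCompactOperator a) :
    schattenSum r (a * b) ≤ schattenSum p a + schattenSum q b := by
  obtain ⟨ι, f, c, hc, hf⟩ := exists_eigenbasis ha hac
  have hq0 : 0 < q := by linarith
  rw [schattenSum_of_nonneg ha hp, schattenSum_of_nonneg hb hq0, trace_rpow_eq_tsum f ha hf hp.le, schattenSum,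
    trace_rpow_eq_tsum_inner f,
    trace_rpow_eq_tsum_inner f]
  exact tsum_ofReal_add_le (inv_nonneg.2 hr.le) (inv_nonneg.2 hp.le) (inv_nonneg.2 hq0.le)
    (fun i => Real.rpow_nonneg (hc i) p) (fun i => re_inner_rpow_nonneg _ _ _)
    fun i => (young_eigenvector ha hb hp hq hr hr' h (hc i) (f.orthonormal.1 i) (hf i)).1

theorem rpow_eq_rpow_of_schattenSum_mul_eq_of_two_lt {a b : H →L[ℂ] H} (ha : 0 ≤ a) (hb : 0 ≤ b)
    {p q r : ℝ} (hp : 0 < p) (hq : 2 < q) (hr : 0 < r) (hr' : r ≤ 2) (h : r⁻¹ = p⁻¹ + q⁻¹)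
    (hac : IsCompactOperator a) (heq : schattenSum r (a * b) = schattenSum p a + schattenSum q b)
    (hfin : schattenSum r (a * b) ≠ ⊤) : a ^ p = b ^ q := by
  obtain ⟨ι, f, c, hc, hf⟩ := exists_eigenbasis ha hac
  have hq0 : 0 < q := by linarith
  rw [schattenSum_of_nonneg ha hp, schattenSum_of_nonneg hb hq0, trace_rpow_eq_tsum f ha hf hp.le, schattenSum,
    trace_rpow_eq_tsum_inner f,
    trace_rpow_eq_tsum_inner f] at heq
  rw [schattenSum, trace_rpow_eq_tsum_inner f] at hfin
  have hv := fun i => young_eigenvector ha hb hp hq hr hr' h (hc i) (f.orthonormal.1 i) (hf i)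
  refine ext_hilbertBasis f fun i => (hv i).2 ?_
  exact eq_of_tsum_ofReal_add_eq (inv_nonneg.2 hr.le) (inv_nonneg.2 hp.le)
    (inv_nonneg.2 hq0.le) (fun i => re_inner_rpow_nonneg _ _ _)
    (fun i => Real.rpow_nonneg (hc i) p) (fun i => re_inner_rpow_nonneg _ _ _)
    (fun i => (hv i).1) heq hfin i

/-- Replacing `X` by `|X| = √(X*X)` changes neither `(Xb)*(Xb)` nor `X*X`; passing to adjoints
reduces to positive factors. This is needed to iterate, since a product of positive operators is not
positive in general. -/
theorem schattenSum_mul_le_of_isCompactOperator {X b : H →L[ℂ] H} (hX : IsCompactOperator X)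
    (hb : 0 ≤ b) {p q r : ℝ} (hp : 0 < p) (hq : 2 < q) (hr : 0 < r) (hr' : r ≤ 2)
    (h : r⁻¹ = p⁻¹ + q⁻¹) :
    schattenSum r (X * b) ≤ schattenSum p X + schattenSum q b := by
  set a := CFC.sqrt (star X * X) with ha
  have ha0 : 0 ≤ a := CFC.sqrt_nonneg _
  have hsa : star a = a := (IsSelfAdjoint.of_nonneg ha0).star_eq
  have hsb : star b = b := (IsSelfAdjoint.of_nonneg hb).star_eq
  have haa : a * a = star X * X := CFC.sqrt_mul_sqrt_self _ (star_mul_self_nonneg X)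
  have hac : IsCompactOperator a := by
    refine isCompactOperator_of_mul_self (IsSelfAdjoint.of_nonneg ha0) ?_
    rw [haa]
    exact isCompactOperator_mul_left hX _
  have h1 : schattenSum r (star (X * b)) = schattenSum r (star (a * b)) := by
    rw [schattenSum, schattenSum, star_star, star_star, star_mul, star_mul, hsa, mul_assoc,
      ← mul_assoc (star X), ← haa]
    simp only [mul_assoc]
  have h2 : schattenSum p a = schattenSum p (star X) := by
    rw [schattenSum, schattenSum, star_star, hsa, haa]
  calc schattenSum r (X * b) ≤ schattenSum r (star (X * b)) :=
        schattenSum_le_star (hX.comp_clm b) hr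
    _ = schattenSum r (star (a * b)) := h1
    _ ≤ schattenSum r (a * b) := schattenSum_star_le (hac.comp_clm b) hr
    _ ≤ schattenSum p a + schattenSum q b :=
        schattenSum_mul_le_of_two_lt ha0 hb hp hq hr hr' h hac
    _ ≤ schattenSum p X + schattenSum q b := by
        rw [h2]
        gcongr
        exact schattenSum_star_le hX hp

theorem schattenSum_mul_pow_le {X b : H →L[ℂ] H} (hX : IsCompactOperator X) (hb : 0 ≤ b)
    {p q : ℝ} (hp : 0 < p) (hp' : p ≤ 2) (hq : 2 < q) (n : ℕ) :
    schattenSum (p⁻¹ + n * q⁻¹)⁻¹ (X * b ^ n) ≤ schattenSum p X + n * schattenSum q b := by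
  have hq0 : 0 < q := by linarith
  induction n with
  | zero => simp
  | succ n ih =>
    have hpos : 0 < p⁻¹ + n * q⁻¹ := by positivity
    have hpos' : 0 < p⁻¹ + (n + 1 : ℕ) * q⁻¹ := by positivity
    -- Each further factor lowers the index, so it never exceeds `p ≤ 2`.
    have hle : (p⁻¹ + (n + 1 : ℕ) * q⁻¹)⁻¹ ≤ 2 := by
      refine (inv_anti₀ (inv_pos.2 hp) (le_add_of_nonneg_right (by positivity))).trans ?_
      rwa [inv_inv]
    have h1 := schattenSum_mul_le_of_isCompactOperator (X := X * b ^ n) (hX.comp_clm _) hb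
      (inv_pos.2 hpos) hq (inv_pos.2 hpos') hle (by rw [inv_inv, inv_inv]; push_cast; ring)
    rw [pow_succ, ← mul_assoc]
    refine h1.trans ?_
    push_cast
    rw [add_mul, one_mul, ← add_assoc]
    gcongr

/-! ### Both indices above two: singular vectors -/

theorem eq_of_singular_pair {a b : H →L[ℂ] H} (ha : 0 ≤ a) {g h : H}
    (hg : ‖g‖ = 1) (hh : ‖h‖ = 1) {s t : ℝ} (hs : s ≠ 0) (ht : t ≠ 0) (hag : a g = s • g)
    (hbh : b h = t • h) (hab : a (b h) = (s * t) • g) : g = h := by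
  have h1 : a h = s • g := by
    have h2 : a (t • h) = t • a h := a.map_smul_of_tower _ _
    rw [hbh, h2, mul_comm, ← smul_smul] at hab
    exact smul_right_injective H ht hab
  -- Here `⟨a g, h⟩ = s⟨g, h⟩` and `⟨g, a h⟩ = s`, so `⟨g, h⟩ = 1`: equality in Cauchy–Schwarz for
  -- unit vectors.
  have h3 : inner ℂ (a g) h = inner ℂ g (a h) := (IsSelfAdjoint.of_nonneg ha).isSymmetric g h
  rw [hag, h1, inner_smul_left_eq_star_smul, inner_smul_right_eq_smul, starRingEnd_apply,
    star_trivial] at h3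
  have h4 := smul_right_injective ℂ hs h3
  rw [inner_self_eq_norm_sq_to_K, hg] at h4
  exact (inner_eq_one_iff_of_norm_eq_one hg hh).1 (by simpa using h4)

/-- Since `x = ⟨f, a b e⟩ = ⟨a f, b e⟩ ≤ ‖a f‖‖b e‖`, scalar Young and Jensen on each factor apply.
Equality makes `f` and `e` eigenvectors of `a` and `b`, and then `eq_of_singular_pair` identifies
them. -/
theorem young_singular_pair {a b : H →L[ℂ] H} (ha : 0 ≤ a) (hb : 0 ≤ b) {p q r : ℝ}
    (hp : 2 < p) (hq : 2 < q) (hr : 0 < r) (h : r⁻¹ = p⁻¹ + q⁻¹) {x : ℝ} (hx : 0 < x) {f e : H}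
    (hf : ‖f‖ = 1) (he : ‖e‖ = 1) (hab : a (b e) = x • f) :
    r⁻¹ * x ^ r ≤
        p⁻¹ * RCLike.re (inner ℂ f ((a ^ p) f)) + q⁻¹ * RCLike.re (inner ℂ e ((b ^ q) e)) ∧
      (r⁻¹ * x ^ r =
        p⁻¹ * RCLike.re (inner ℂ f ((a ^ p) f)) + q⁻¹ * RCLike.re (inner ℂ e ((b ^ q) e)) →
        f = e ∧ (a ^ p) f = (b ^ q) f) := by
  have hp0 : 0 < p := by linarith
  have hq0 : 0 < q := by linarith
  have hxle : x ≤ ‖a f‖ * ‖b e‖ := by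
    have h3 : inner ℂ (a f) (b e) = inner ℂ f (a (b e)) :=
      (IsSelfAdjoint.of_nonneg ha).isSymmetric f (b e)
    rw [hab, inner_smul_right_eq_smul, inner_self_eq_norm_sq_to_K, hf] at h3
    have h4 := norm_inner_le_norm (𝕜 := ℂ) (a f) (b e)
    rw [h3, norm_smul] at h4
    simpa [abs_of_pos hx] using h4
  have hy := young_rpow hp0 hq0 hr h (norm_nonneg (a f)) (norm_nonneg (b e))
  have h0 : r⁻¹ * x ^ r ≤ r⁻¹ * (‖a f‖ * ‖b e‖) ^ r :=
    mul_le_mul_of_nonneg_left (Real.rpow_le_rpow hx.le hxle hr.le) (inv_nonneg.2 hr.le)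
  have h1 := mul_le_mul_of_nonneg_left (norm_rpow_le_re_inner ha hp.le hf) (inv_nonneg.2 hp0.le)
  have h2 := mul_le_mul_of_nonneg_left (norm_rpow_le_re_inner hb hq.le he) (inv_nonneg.2 hq0.le)
  refine ⟨by linarith, fun heq => ?_⟩
  have h3 := eq_of_young_rpow_eq hp0 hq0 hr h (norm_nonneg (a f)) (norm_nonneg (b e))
    (le_antisymm hy (by linarith))
  have h4 : RCLike.re (inner ℂ f ((a ^ p) f)) = ‖a f‖ ^ p :=
    mul_left_cancel₀ (inv_ne_zero hp0.ne') (by linarith)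
  have h5 : RCLike.re (inner ℂ e ((b ^ q) e)) = ‖b e‖ ^ q :=
    mul_left_cancel₀ (inv_ne_zero hq0.ne') (by linarith)
  have h6 : x = ‖a f‖ * ‖b e‖ := by
    have : x ^ r = (‖a f‖ * ‖b e‖) ^ r := mul_left_cancel₀ (inv_ne_zero hr.ne') (by linarith)
    exact (Real.rpow_left_inj hx.le (by positivity) hr.ne').1 this
  have hpos : 0 < ‖a f‖ * ‖b e‖ := h6 ▸ hx
  have hfe : f = e := eq_of_singular_pair ha hf he (left_ne_zero_of_mul hpos.ne')
    (right_ne_zero_of_mul hpos.ne') (eigenvector_of_norm_rpow_eq ha hp hf h4)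
    (eigenvector_of_norm_rpow_eq hb hq he h5) (by rw [hab, h6])
  refine ⟨hfe, ?_⟩
  subst hfe
  rw [rpow_apply_eigenvector ha hp0.le (eigenvector_of_norm_rpow_eq ha hp hf h4),
    rpow_apply_eigenvector hb hq0.le (eigenvector_of_norm_rpow_eq hb hq hf h5), h3]

theorem trace_mul_star_rpow_eq_tsum {ι : Type*} {X : H →L[ℂ] H} {f : HilbertBasis ι ℂ H}
    {x : ι → ℝ} {e : ι → H} (hx : ∀ i, 0 ≤ x i) (hf : ∀ i, star X (f i) = x i • e i)
    (he : ∀ i, X (e i) = x i • f i) {r : ℝ} (hr : 0 < r) :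
    trace ((X * star X) ^ (r / 2)) = ∑' i : {i // x i ≠ 0}, ENNReal.ofReal (x i ^ r) := by
  have h1 : ∀ i, (X * star X) (f i) = (x i ^ 2) • f i := by
    intro i
    have h2 : X (x i • e i) = x i • X (e i) := X.map_smul_of_tower _ _
    rw [mul_apply_eq_comp, hf, h2, he, smul_smul, sq]
  rw [trace_rpow_eq_tsum f (mul_star_self_nonneg X) h1 (by positivity),
    ← tsum_subtype_eq_of_support_subset (s := {i | x i ≠ 0})]
  · exact tsum_congr fun i => by rw [sq_rpow_half (hx i)]
  · intro i hi hi0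
    refine hi ?_
    dsimp only
    rw [hi0, sq_rpow_half le_rfl, Real.zero_rpow hr.ne', ENNReal.ofReal_zero]

theorem eq_and_eq_of_mul_add_mul_eq {c d A B A' B' : ℝ≥0∞} (hc : c ≠ 0) (hc' : c ≠ ⊤)
    (hd : d ≠ 0) (hd' : d ≠ ⊤) (hA : A ≤ A') (hB : B ≤ B') (h : c * A + d * B = c * A' + d * B')
    (hfin : c * A + d * B ≠ ⊤) : A = A' ∧ B = B' := by
  have hA1 := mul_le_mul_right hA c
  have hB1 := mul_le_mul_right hB d
  obtain ⟨hf1, hf2⟩ := ENNReal.add_ne_top.1 hfin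
  constructor
  · by_contra hne
    exact (ENNReal.add_lt_add_of_lt_of_le hf2
      (ENNReal.mul_lt_mul_right hc hc' (lt_of_le_of_ne hA hne)) hB1).ne h
  · by_contra hne
    exact (ENNReal.add_lt_add_of_le_of_lt hf1 hA1
      (ENNReal.mul_lt_mul_right hd hd' (lt_of_le_of_ne hB hne))).ne h

theorem eq_zero_of_tsum_subtype_eq {ι : Type*} {s : Set ι} {u : ι → ℝ≥0∞}
    (h : ∑' i : s, u i = ∑' i, u i) (hfin : ∑' i, u i ≠ ⊤) {i : ι} (hi : i ∉ s) : u i = 0 := by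
  rw [tsum_subtype] at h
  have h1 := eq_of_tsum_eq_of_le (fun i => Set.indicator_le_self s u i) h (h ▸ hfin) i
  rw [← h1, Set.indicator_of_notMem hi]

/-- Young's inequality for Schatten norms, with indices greater than `2`, and its case of
equality. -/
theorem schattenSum_mul_le_of_two_lt_of_two_lt {a b : H →L[ℂ] H} (ha : 0 ≤ a) (hb : 0 ≤ b)
    {p q r : ℝ} (hp : 2 < p) (hq : 2 < q) (hr : 0 < r) (h : r⁻¹ = p⁻¹ + q⁻¹)
    (hac : IsCompactOperator a) :
    schattenSum r (a * b) ≤ schattenSum p a + schattenSum q b ∧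
      (schattenSum r (a * b) = schattenSum p a + schattenSum q b →
        schattenSum p a + schattenSum q b ≠ ⊤ → a ^ p = b ^ q) := by
  have hp0 : 0 < p := by linarith
  have hq0 : 0 < q := by linarith
  have hXc : IsCompactOperator (star (star (a * b)) * star (a * b)) := by
    rw [star_star, mul_star_mul_of_nonneg ha hb]
    exact isCompactOperator_mul_left hac _
  -- The system is taken for `(ab)*`, so that `f` is a full basis diagonalising `(ab)(ab)*` and `a b
  -- e i = x i • f i`.
  obtain ⟨ι, f, x, e, hx, hf, he, heo⟩ := exists_singular_system hXc
  rw [star_star] at he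
  have hxpos : ∀ i : {i // x i ≠ 0}, 0 < x i := fun i => lt_of_le_of_ne (hx i) (Ne.symm i.2)
  have hv := fun i : {i // x i ≠ 0} => young_singular_pair ha hb hp hq hr h (hxpos i)
    (f.orthonormal.1 i) (heo.1 i) (he i)
  have h1 : schattenSum r (a * b) ≤
      ENNReal.ofReal p⁻¹ * (∑' i : {i // x i ≠ 0},
        ENNReal.ofReal (RCLike.re (inner ℂ (f i) ((a ^ p) (f i))))) +
      ENNReal.ofReal q⁻¹ * (∑' i : {i // x i ≠ 0},
        ENNReal.ofReal (RCLike.re (inner ℂ (e i) ((b ^ q) (e i))))) := by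
    rw [schattenSum, trace_mul_star_rpow_eq_tsum hx hf he hr]
    exact tsum_ofReal_add_le (inv_nonneg.2 hr.le) (inv_nonneg.2 hp0.le) (inv_nonneg.2 hq0.le)
      (fun i => re_inner_rpow_nonneg _ _ _) (fun i => re_inner_rpow_nonneg _ _ _)
      fun i => (hv i).1
  have hA : (∑' i : {i // x i ≠ 0},
      ENNReal.ofReal (RCLike.re (inner ℂ (f i) ((a ^ p) (f i))))) ≤ trace (a ^ p) :=
    tsum_le_trace (f.orthonormal.comp _ Subtype.val_injective) (A := a ^ p) CFC.rpow_nonneg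
  have hB : (∑' i : {i // x i ≠ 0},
      ENNReal.ofReal (RCLike.re (inner ℂ (e i) ((b ^ q) (e i))))) ≤ trace (b ^ q) :=
    tsum_le_trace heo (A := b ^ q) CFC.rpow_nonneg
  rw [schattenSum_of_nonneg ha hp0, schattenSum_of_nonneg hb hq0]
  have h2 := add_le_add (mul_le_mul_right hA (ENNReal.ofReal p⁻¹))
    (mul_le_mul_right hB (ENNReal.ofReal q⁻¹))
  refine ⟨h1.trans h2, fun heq hfin => ?_⟩
  have h3 := le_antisymm h2 (heq ▸ h1)
  obtain ⟨hA', hB'⟩ := eq_and_eq_of_mul_add_mul_eq (by simpa using hp0) ENNReal.ofReal_ne_top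
    (by simpa using hq0) ENNReal.ofReal_ne_top hA hB h3 (h3 ▸ hfin)
  have h4 := heq.trans h3.symm
  rw [schattenSum, trace_mul_star_rpow_eq_tsum hx hf he hr] at h4
  have h5 := eq_of_tsum_ofReal_add_eq (inv_nonneg.2 hr.le) (inv_nonneg.2 hp0.le)
    (inv_nonneg.2 hq0.le) (fun i : {i // x i ≠ 0} => Real.rpow_nonneg (hx i) r)
    (fun i => re_inner_rpow_nonneg _ _ _) (fun i => re_inner_rpow_nonneg _ _ _)
    (fun i => (hv i).1) h4 (by rw [h4, h3]; exact hfin)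
  have h6 := fun i => (hv i).2 (h5 i)
  have hfinA : trace (a ^ p) ≠ ⊤ := fun hT => hfin (by simp [hT, hp0])
  have hfinB : trace (b ^ q) ≠ ⊤ := fun hT => hfin (by simp [hT, hq0])
  rw [trace_rpow_eq_tsum_inner f] at hA' hB' hfinA hfinB
  -- Because `e i = f i`, the vectors `f i` with `x i ≠ 0` exhaust the trace of `b ^ q` as well as
  -- that of `a ^ p`. Both operators therefore vanish on the remaining basis vectors.
  have hB'' : (∑' i : {i // x i ≠ 0},
      ENNReal.ofReal (RCLike.re (inner ℂ (f i) ((b ^ q) (f i))))) =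
      ∑' i, ENNReal.ofReal (RCLike.re (inner ℂ (f i) ((b ^ q) (f i)))) := by
    rw [← hB']
    exact tsum_congr fun i => by rw [(h6 i).1]
  refine ext_hilbertBasis f fun i => ?_
  by_cases hi : x i = 0
  · have hi' : i ∉ {i | x i ≠ 0} := fun h => h hi
    have h7 := eq_zero_of_tsum_subtype_eq hA' hfinA hi'
    have h8 := eq_zero_of_tsum_subtype_eq hB'' hfinB hi'
    rw [ENNReal.ofReal_eq_zero] at h7 h8
    rw [apply_eq_zero_of_re_inner_eq_zero (A := a ^ p) CFC.rpow_nonneg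
        (le_antisymm h7 (re_inner_rpow_nonneg _ _ _)),
      apply_eq_zero_of_re_inner_eq_zero (A := b ^ q) CFC.rpow_nonneg
        (le_antisymm h8 (re_inner_rpow_nonneg _ _ _))]
  · exact (h6 ⟨i, hi⟩).2

/-! ### Small indices, and the general inequality -/

theorem schattenSum_rpow_inv {b : H →L[ℂ] H} (hb : 0 ≤ b) {q : ℝ} (hq : 0 < q) {n : ℕ}
    (hn : n ≠ 0) : schattenSum q b = n * schattenSum (n * q) (b ^ (n : ℝ)⁻¹) := by
  have hn' : (0 : ℝ) < n := by exact_mod_cast Nat.pos_of_ne_zero hn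
  have h0 : 0 ≤ b ^ (n : ℝ)⁻¹ := CFC.rpow_nonneg
  rw [schattenSum_of_nonneg hb hq, schattenSum_of_nonneg h0 (by positivity),
    rpow_rpow_of_nonneg hb (by positivity) (by positivity), inv_mul_cancel_left₀ hn'.ne',
    ← mul_assoc, ← ENNReal.ofReal_natCast n, ← ENNReal.ofReal_mul hn'.le]
  congr 2
  field_simp

/-- Young's inequality for Schatten norms, with indices at most `2`, and its case of equality. -/
theorem schattenSum_mul_le_of_le_two {a b : H →L[ℂ] H} (ha : 0 ≤ a) (hb : 0 ≤ b)
    {p q r : ℝ} (hp : 0 < p) (hp' : p ≤ 2) (hq : 0 < q) (h : r⁻¹ = p⁻¹ + q⁻¹)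
    (hac : IsCompactOperator a) :
    schattenSum r (a * b) ≤ schattenSum p a + schattenSum q b ∧
      (schattenSum r (a * b) = schattenSum p a + schattenSum q b →
        schattenSum p a + schattenSum q b ≠ ⊤ → a ^ p = b ^ q) := by
  -- The root `β` of order `m + 1` has index `(m + 1) q > 2`. One copy is kept next to `a` for the
  -- equality case; the other `m` are peeled off.
  obtain ⟨m, hm⟩ := exists_nat_gt (2 / q)
  rw [div_lt_iff₀ hq] at hm
  have hn : (0 : ℝ) < (m + 1 : ℕ) := by positivity
  set β := b ^ ((m + 1 : ℕ) : ℝ)⁻¹ with hβ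
  have hβ0 : 0 ≤ β := CFC.rpow_nonneg
  have hs : 2 < (m + 1 : ℕ) * q := by push_cast; linarith
  have hs0 : 0 < (m + 1 : ℕ) * q := by positivity
  have hbβ : b = β * β ^ m := by
    rw [← pow_succ', ← CFC.rpow_natCast β _ hβ0, hβ,
      rpow_rpow_of_nonneg hb (by positivity) (by positivity), inv_mul_cancel₀ hn.ne',
      CFC.rpow_one b hb]
  have hbq : b ^ q = β ^ ((m + 1 : ℕ) * q) := by
    rw [hβ, rpow_rpow_of_nonneg hb (by positivity) (by positivity), inv_mul_cancel_left₀ hn.ne']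
  set p₁ := (p⁻¹ + ((m + 1 : ℕ) * q)⁻¹)⁻¹ with hp₁
  have hp₁0 : 0 < p₁ := by positivity
  have hp₁2 : p₁ ≤ 2 := by
    refine (inv_anti₀ (inv_pos.2 hp) (le_add_of_nonneg_right (by positivity))).trans ?_
    rwa [inv_inv]
  have hp₁inv : p₁⁻¹ = p⁻¹ + ((m + 1 : ℕ) * q)⁻¹ := by rw [hp₁, inv_inv]
  have hr : r = (p₁⁻¹ + m * ((m + 1 : ℕ) * q)⁻¹)⁻¹ := by
    rw [← inv_inv r, h, hp₁inv]
    congr 1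
    push_cast
    field_simp
    ring
  have h1 : schattenSum r (a * b) ≤
      schattenSum p₁ (a * β) + m * schattenSum ((m + 1 : ℕ) * q) β := by
    rw [hr, hbβ, ← mul_assoc]
    exact schattenSum_mul_pow_le (hac.comp_clm β) hβ0 hp₁0 hp₁2 hs m
  have h2 : schattenSum p₁ (a * β) ≤ schattenSum p a + schattenSum ((m + 1 : ℕ) * q) β :=
    schattenSum_mul_le_of_two_lt ha hβ0 hp hs hp₁0 hp₁2 hp₁inv hac
  have h3 : schattenSum p a + schattenSum q b =
      schattenSum p a + schattenSum ((m + 1 : ℕ) * q) β +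
        m * schattenSum ((m + 1 : ℕ) * q) β := by
    rw [schattenSum_rpow_inv hb hq m.succ_ne_zero, ← hβ]
    generalize schattenSum _ β = S
    push_cast
    ring
  rw [h3]
  have h4 := add_le_add_left h2 (m * schattenSum ((m + 1 : ℕ) * q) β)
  refine ⟨h1.trans h4, fun heq hfin => ?_⟩
  obtain ⟨hfin1, hfin2⟩ := ENNReal.add_ne_top.1 hfin
  have h5 := le_antisymm h4 (heq ▸ h1)
  -- Equality overall forces it for the pair `a, β`; cancelling the finite remainder isolates it,
  -- and `β ^ ((m + 1) q) = b ^ q`.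
  have h6 := (ENNReal.add_left_inj hfin2).1 h5
  rw [hbq]
  exact rpow_eq_rpow_of_schattenSum_mul_eq_of_two_lt ha hβ0 hp hs hp₁0 hp₁2 hp₁inv hac h6
    (h6 ▸ hfin1)

/-- Young's inequality `r⁻¹ ‖ab‖_r^r ≤ p⁻¹ ‖a‖_p^p + q⁻¹ ‖b‖_q^q` for Schatten norms, where
`r⁻¹ = p⁻¹ + q⁻¹`, and its case of equality. -/
theorem schattenSum_mul_le {a b : H →L[ℂ] H} (ha : 0 ≤ a) (hb : 0 ≤ b) {p q r : ℝ} (hp : 0 < p)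
    (hq : 0 < q) (hr : 0 < r) (h : r⁻¹ = p⁻¹ + q⁻¹) (hTa : trace (a ^ p) < ⊤)
    (hTb : trace (b ^ q) < ⊤) :
    schattenSum r (a * b) ≤ schattenSum p a + schattenSum q b ∧
      (schattenSum r (a * b) = schattenSum p a + schattenSum q b → a ^ p = b ^ q) := by
  have hac := isCompactOperator_of_trace_rpow_lt_top ha hp hTa
  have hbc := isCompactOperator_of_trace_rpow_lt_top hb hq hTb
  have hfin : schattenSum p a + schattenSum q b ≠ ⊤ := by
    rw [schattenSum_of_nonneg ha hp, schattenSum_of_nonneg hb hq]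
    exact ENNReal.add_ne_top.2 ⟨ENNReal.mul_ne_top ENNReal.ofReal_ne_top hTa.ne,
      ENNReal.mul_ne_top ENNReal.ofReal_ne_top hTb.ne⟩
  rcases le_or_gt r 2 with hr2 | hr2
  · rcases lt_or_ge 2 q with hq2 | hq2
    · exact ⟨schattenSum_mul_le_of_two_lt ha hb hp hq2 hr hr2 h hac, fun heq =>
        rpow_eq_rpow_of_schattenSum_mul_eq_of_two_lt ha hb hp hq2 hr hr2 h hac heq (heq ▸ hfin)⟩
    rcases lt_or_ge 2 p with hp2 | hp2
    -- For `q ≤ 2 < p` the factors trade places, as `ba` is the adjoint of `ab`.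
    · have h' : r⁻¹ = q⁻¹ + p⁻¹ := by rw [h, add_comm]
      have h1 : schattenSum r (a * b) ≤ schattenSum r (b * a) := by
        have := schattenSum_le_star (X := a * b) (hac.comp_clm b) hr
        rwa [star_mul, (IsSelfAdjoint.of_nonneg ha).star_eq,
          (IsSelfAdjoint.of_nonneg hb).star_eq] at this
      have h2 := schattenSum_mul_le_of_two_lt hb ha hq hp2 hr hr2 h' hbc
      rw [add_comm] at h2
      refine ⟨h1.trans h2, fun heq => Eq.symm ?_⟩
      have h3 := le_antisymm h2 (heq ▸ h1)
      rw [add_comm] at h3 hfin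
      exact rpow_eq_rpow_of_schattenSum_mul_eq_of_two_lt hb ha hq hp2 hr hr2 h' hbc h3 (h3 ▸ hfin)
    · have h1 := schattenSum_mul_le_of_le_two ha hb hp hp2 hq h hac
      exact ⟨h1.1, fun heq => h1.2 heq hfin⟩
  · have h2 : r⁻¹ < 2⁻¹ := inv_strictAnti₀ two_pos hr2
    have hp2 : 2 < p := by
      rw [← inv_lt_inv₀ hp two_pos]
      linarith [inv_pos.2 hq]
    have hq2 : 2 < q := by
      rw [← inv_lt_inv₀ hq two_pos]
      linarith [inv_pos.2 hp]
    have h1 := schattenSum_mul_le_of_two_lt_of_two_lt ha hb hp2 hq2 hr h hac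
    exact ⟨h1.1, fun heq => h1.2 heq hfin⟩

end Hoelder

/-! ### Scaling of `Q` and the bounds on the divergence -/

section Divergence

universe u
variable {H : Type u} [NormedAddCommGroup H] [InnerProductSpace ℂ H] [CompleteSpace H]

theorem rhoSigma_eq {α z : ℝ} (hα : 1 < α) (hz : 0 < z) {ρ σ T : H →L[ℂ] H} (hσ : 0 ≤ σ)
    (hT : 0 ≤ T) (hsupp : suppProj T ≤ suppProj σ)
    (h : ρ ^ (α / z) = σ ^ ((α - 1) / (2 * z)) * T * σ ^ ((α - 1) / (2 * z))) :
    rhoSigma α z ρ σ = T :=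
  (existsUnique_rhoSigma hα hz hσ ⟨T, h⟩).unique (rhoSigma_spec hα hz hσ ⟨T, h⟩) ⟨hT, hsupp, h⟩

/-- For `ρ = σ` the operator `rhoSigma` is `σ ^ z⁻¹`. -/
theorem Q_self {α z : ℝ} (hα : 1 < α) (hz : 0 < z) {σ : H →L[ℂ] H} (hσ : 0 ≤ σ) :
    Q α z σ σ = trace σ := by
  have he : 0 < (α - 1) / (2 * z) := div_pos (by linarith) (by linarith)
  have hz' : 0 < z⁻¹ := inv_pos.2 hz
  have h : σ ^ (α / z) =
      σ ^ ((α - 1) / (2 * z)) * σ ^ z⁻¹ * σ ^ ((α - 1) / (2 * z)) := by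
    rw [← rpow_add_of_pos he hz', ← rpow_add_of_pos (by positivity) he]
    congr 1
    field_simp
    ring
  have hT : 0 ≤ σ ^ z⁻¹ := CFC.rpow_nonneg
  have hs : suppProj (σ ^ z⁻¹) ≤ suppProj σ := by
    rw [suppProj_le_iff, ker_rpow hσ hz']
  have hM : MemB α z σ σ := ⟨_, h⟩
  rw [Q, if_pos hM, rhoSigma_eq hα hz hσ hT hs h,
    rpow_rpow_of_nonneg hσ hz'.le hz.le, inv_mul_cancel₀ hz.ne', CFC.rpow_one σ hσ]

theorem smul_sandwich {α z : ℝ} (hα : 1 < α) (hz : 0 < z) {σ : H →L[ℂ] H} (hσ : 0 ≤ σ) {t : ℝ}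
    (ht : 0 < t) (R : H →L[ℂ] H) :
    (t • σ) ^ ((α - 1) / (2 * z)) * ((t ^ ((α - 1) / z))⁻¹ • R) * (t • σ) ^ ((α - 1) / (2 * z)) =
      σ ^ ((α - 1) / (2 * z)) * R * σ ^ ((α - 1) / (2 * z)) := by
  have he : 0 < (α - 1) / (2 * z) := div_pos (by linarith) (by linarith)
  rw [smul_rpow hσ ht he.le]
  simp only [smul_mul_assoc, mul_smul_comm, smul_smul]
  have : t ^ ((α - 1) / (2 * z)) * (t ^ ((α - 1) / z))⁻¹ * t ^ ((α - 1) / (2 * z)) = 1 := by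
    rw [← Real.rpow_neg ht.le, ← Real.rpow_add ht, ← Real.rpow_add ht,
      show (α - 1) / (2 * z) + -((α - 1) / z) + (α - 1) / (2 * z) = 0 by field_simp; ring,
      Real.rpow_zero]
  convert one_smul ℝ _
  linarith

theorem memB_smul {α z : ℝ} (hα : 1 < α) (hz : 0 < z) {ρ σ : H →L[ℂ] H} (hσ : 0 ≤ σ) {t : ℝ}
    (ht : 0 < t) (h : MemB α z ρ σ) : MemB α z ρ (t • σ) := by
  obtain ⟨R, hR⟩ := h
  exact ⟨_, hR.trans (smul_sandwich hα hz hσ ht R).symm⟩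

theorem memB_smul_iff {α z : ℝ} (hα : 1 < α) (hz : 0 < z) {ρ σ : H →L[ℂ] H} (hσ : 0 ≤ σ) {t : ℝ}
    (ht : 0 < t) : MemB α z ρ (t • σ) ↔ MemB α z ρ σ := by
  refine ⟨fun h => ?_, memB_smul hα hz hσ ht⟩
  have := memB_smul hα hz (smul_nonneg ht.le hσ) (inv_pos.2 ht) h
  rwa [smul_smul, inv_mul_cancel₀ ht.ne', one_smul] at this

/-- Scaling `σ` by `t` multiplies the sandwiched operator by `t ^ (-(α - 1) / z)`; the power `z`
turns this into `t ^ (1 - α)`. -/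
theorem Q_smul {α z : ℝ} (hα : 1 < α) (hz : 0 < z) {ρ σ : H →L[ℂ] H} (hσ : 0 ≤ σ) {t : ℝ}
    (ht : 0 < t) : Q α z ρ (t • σ) = ENNReal.ofReal (t ^ (1 - α)) * Q α z ρ σ := by
  by_cases hM : MemB α z ρ σ
  · obtain ⟨hT, hs, h⟩ := rhoSigma_spec hα hz hσ hM
    have hc : 0 < (t ^ ((α - 1) / z))⁻¹ := inv_pos.2 (Real.rpow_pos_of_pos ht _)
    have hs' : suppProj ((t ^ ((α - 1) / z))⁻¹ • rhoSigma α z ρ σ) ≤ suppProj (t • σ) := by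
      rw [suppProj_le_iff] at hs ⊢
      intro x hx
      have h1 : t • σ x = 0 := hx
      have h2 : rhoSigma α z ρ σ x = 0 := hs ((smul_eq_zero.1 h1).resolve_left ht.ne')
      change (t ^ ((α - 1) / z))⁻¹ • rhoSigma α z ρ σ x = 0
      rw [h2, smul_zero]
    rw [Q, if_pos (memB_smul hα hz hσ ht hM), Q, if_pos hM,
      rhoSigma_eq hα hz (smul_nonneg ht.le hσ) (smul_nonneg hc.le hT) hs'
        (h.trans (smul_sandwich hα hz hσ ht _).symm),
      smul_rpow hT hc hz.le, trace_smul (Real.rpow_nonneg hc.le z)]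
    congr 2
    rw [← Real.rpow_neg ht.le, ← Real.rpow_mul ht.le]
    congr 1
    field_simp
    ring
  · rw [Q, if_neg (fun h => hM ((memB_smul_iff hα hz hσ ht).1 h)), Q, if_neg hM,
      ENNReal.mul_top (by simpa using Real.rpow_pos_of_pos ht _)]

theorem schattenSum_sandwich {α z : ℝ} (hα : 1 < α) (hz : 0 < z) {ρ σ T : H →L[ℂ] H} (hρ : 0 ≤ ρ)
    (hT : 0 ≤ T) (h : ρ ^ (α / z) = σ ^ ((α - 1) / (2 * z)) * T * σ ^ ((α - 1) / (2 * z))) :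
    schattenSum (2 * z / α) (σ ^ ((α - 1) / (2 * z)) * CFC.sqrt T) =
      ENNReal.ofReal (α / (2 * z)) * trace ρ := by
  have h0 : 0 ≤ σ ^ ((α - 1) / (2 * z)) := CFC.rpow_nonneg
  rw [schattenSum, mul_star_mul_of_nonneg h0 (CFC.sqrt_nonneg T), CFC.sqrt_mul_sqrt_self T hT, ← h,
    rpow_rpow_of_nonneg hρ (by positivity) (by positivity), inv_div]
  rw [show α / z * (2 * z / α / 2) = 1 by field_simp, CFC.rpow_one ρ hρ]

/-- Young's inequality for `Q`. -/
theorem mul_trace_le_Q_add {α z : ℝ} (hα : 1 < α) (hz : 0 < z) {ρ σ : H →L[ℂ] H} (hρ : 0 ≤ ρ)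
    (hσ : 0 ≤ σ) (hTσ : trace σ < ⊤) (hQ : Q α z ρ σ < ⊤) :
    ENNReal.ofReal α * trace ρ ≤ ENNReal.ofReal (α - 1) * trace σ + Q α z ρ σ ∧
      (ENNReal.ofReal α * trace ρ = ENNReal.ofReal (α - 1) * trace σ + Q α z ρ σ → ρ = σ) := by
  have hM : MemB α z ρ σ := by
    by_contra hM
    rw [Q, if_neg hM] at hQ
    exact lt_irrefl _ hQ
  rw [Q, if_pos hM] at hQ ⊢
  obtain ⟨hT, -, h⟩ := rhoSigma_spec hα hz hσ hM
  set T := rhoSigma α z ρ σ with hTdef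
  have hα1 : 0 < α - 1 := by linarith
  have he : 0 < (α - 1) / (2 * z) := by positivity
  have ha0 : 0 ≤ σ ^ ((α - 1) / (2 * z)) := CFC.rpow_nonneg
  have hp : 0 < 2 * z / (α - 1) := by positivity
  have hq : 0 < 2 * z := by positivity
  have hap : (σ ^ ((α - 1) / (2 * z))) ^ (2 * z / (α - 1)) = σ := by
    rw [rpow_rpow_of_nonneg hσ he.le hp.le, show (α - 1) / (2 * z) * (2 * z / (α - 1)) = 1 by
      field_simp, CFC.rpow_one σ hσ]
  have hbq : CFC.sqrt T ^ (2 * z) = T ^ z := by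
    rw [← mul_self_rpow (CFC.sqrt_nonneg T) hq, CFC.sqrt_mul_sqrt_self T hT]
    congr 1
    ring
  -- The indices are `2z/(α-1)`, `2z` and `2z/α`, whose reciprocals satisfy `α/(2z) = (α-1)/(2z) +
  -- 1/(2z)`. The common factor `(2z)⁻¹` is cancelled below.
  obtain ⟨h1, h2⟩ := schattenSum_mul_le (r := 2 * z / α) ha0 (CFC.sqrt_nonneg T) hp hq
    (by positivity) (by field_simp; ring) (by rwa [hap]) (by rwa [hbq])
  rw [schattenSum_sandwich hα hz hρ hT h, schattenSum_of_nonneg ha0 hp,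
    schattenSum_of_nonneg (CFC.sqrt_nonneg T) hq, hap, hbq] at h1 h2
  have hc : ENNReal.ofReal (2 * z)⁻¹ ≠ 0 := by simpa using hq
  have e1 : ENNReal.ofReal (α / (2 * z)) * trace ρ =
      ENNReal.ofReal (2 * z)⁻¹ * (ENNReal.ofReal α * trace ρ) := by
    rw [← mul_assoc, ← ENNReal.ofReal_mul (by positivity), div_eq_inv_mul]
  have e2 : ENNReal.ofReal (2 * z / (α - 1))⁻¹ * trace σ + ENNReal.ofReal (2 * z)⁻¹ * trace (T ^ z)
      = ENNReal.ofReal (2 * z)⁻¹ * (ENNReal.ofReal (α - 1) * trace σ + trace (T ^ z)) := by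
    rw [mul_add, ← mul_assoc, ← ENNReal.ofReal_mul (by positivity), inv_div, div_eq_inv_mul]
  rw [e1, e2] at h1 h2
  refine ⟨(ENNReal.mul_le_mul_iff_right hc ENNReal.ofReal_ne_top).1 h1, fun heq => ?_⟩
  have hσT : σ = T ^ z := h2 (by rw [heq])
  have hTσ' : T = σ ^ z⁻¹ := by
    rw [hσT, rpow_rpow_of_nonneg hT hz.le (by positivity), mul_inv_cancel₀ hz.ne',
      CFC.rpow_one T hT]
  -- With `T = σ ^ z⁻¹` the exponents in the sandwich add up to `α / z`.
  have hρσ : ρ ^ (α / z) = σ ^ (α / z) := by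
    rw [h, hTσ', ← rpow_add_of_pos he (by positivity), ← rpow_add_of_pos (by positivity) he]
    congr 1
    field_simp
    ring
  have hinv : ∀ A : H →L[ℂ] H, 0 ≤ A → (A ^ (α / z)) ^ (z / α) = A := fun A hA => by
    rw [rpow_rpow_of_nonneg hA (by positivity) (by positivity),
      show α / z * (z / α) = 1 by field_simp, CFC.rpow_one A hA]
  rw [← hinv ρ hρ, hρσ, hinv σ hσ]

/-- Finiteness of `Tr ρ` comes out of Young's inequality, its right-hand side being finite; only
then can the terms be rearranged over the reals. -/
theorem mul_toReal_trace_le {α z : ℝ} (hα : 1 < α) (hz : 0 < z) {ρ σ : H →L[ℂ] H} (hρ : 0 ≤ ρ)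
    (hσ : 0 ≤ σ) (hTσ : trace σ < ⊤) (hQ : Q α z ρ σ < ⊤) :
    trace ρ < ⊤ ∧ α * (trace ρ).toReal + (1 - α) * (trace σ).toReal ≤ (Q α z ρ σ).toReal ∧
      ((Q α z ρ σ).toReal = α * (trace ρ).toReal + (1 - α) * (trace σ).toReal → ρ = σ) := by
  obtain ⟨h1, h2⟩ := mul_trace_le_Q_add hα hz hρ hσ hTσ hQ
  have hα0 : 0 < α := by linarith
  have hα1 : 0 ≤ α - 1 := by linarith
  have hfin : ENNReal.ofReal (α - 1) * trace σ ≠ ⊤ := ENNReal.mul_ne_top ENNReal.ofReal_ne_top hTσ.ne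
  have hfin' : ENNReal.ofReal (α - 1) * trace σ + Q α z ρ σ ≠ ⊤ := ENNReal.add_ne_top.2 ⟨hfin, hQ.ne⟩
  have hTρ : trace ρ < ⊤ := by
    rw [lt_top_iff_ne_top]
    intro hT
    rw [hT, ENNReal.mul_top (by simpa using hα0)] at h1
    exact hfin' (top_le_iff.1 h1)
  have hfin'' : ENNReal.ofReal α * trace ρ ≠ ⊤ := ENNReal.mul_ne_top ENNReal.ofReal_ne_top hTρ.ne
  have e1 : (ENNReal.ofReal α * trace ρ).toReal = α * (trace ρ).toReal := by
    rw [ENNReal.toReal_mul, ENNReal.toReal_ofReal hα0.le]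
  have e2 : (ENNReal.ofReal (α - 1) * trace σ + Q α z ρ σ).toReal =
      (α - 1) * (trace σ).toReal + (Q α z ρ σ).toReal := by
    rw [ENNReal.toReal_add hfin hQ.ne, ENNReal.toReal_mul, ENNReal.toReal_ofReal hα1]
  refine ⟨hTρ, ?_, fun heq => h2 ?_⟩
  · have := ENNReal.toReal_mono hfin' h1
    rw [e1, e2] at this
    linarith
  · rw [← ENNReal.toReal_eq_toReal_iff' hfin'' hfin', e1, e2, heq]
    ring

theorem toReal_trace_pos {A : H →L[ℂ] H} (hA : 0 ≤ A) (hA' : A ≠ 0) (hT : trace A < ⊤) :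
    0 < (trace A).toReal :=
  ENNReal.toReal_pos (fun h => hA' (eq_zero_of_trace_eq_zero hA h)) hT.ne

theorem rpow_mul_rpow_eq_mul_div_rpow {α u v : ℝ} (hu : 0 < u) (hv : 0 < v) :
    u ^ α * v ^ (1 - α) = u * (u / v) ^ (α - 1) := by
  rw [Real.div_rpow hu.le hv.le, Real.rpow_sub_one hu.ne', show 1 - α = -(α - 1) by ring,
    Real.rpow_neg hv.le]
  field_simp

/-- The affine bound is applied to `t • σ` with `t = Tr ρ / Tr σ`. Both traces then agree, so the
bound reads `Tr ρ ≤ t ^ (1 - α) Q`, and its equality case gives `ρ = t • σ`. -/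
theorem rpow_mul_rpow_le_toReal_Q {α z : ℝ} (hα : 1 < α) (hz : 0 < z) {ρ σ : H →L[ℂ] H}
    (hρ : 0 ≤ ρ) (hρ' : ρ ≠ 0) (hσ : 0 ≤ σ) (hσ' : σ ≠ 0) (hTσ : trace σ < ⊤)
    (hQ : Q α z ρ σ < ⊤) :
    (trace ρ).toReal ^ α * (trace σ).toReal ^ (1 - α) ≤ (Q α z ρ σ).toReal ∧
      ((Q α z ρ σ).toReal = (trace ρ).toReal ^ α * (trace σ).toReal ^ (1 - α) →
        ∃ η : ℝ, 0 < η ∧ σ = η • ρ) := by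
  have hTρ := (mul_toReal_trace_le hα hz hρ hσ hTσ hQ).1
  have hu := toReal_trace_pos hρ hρ' hTρ
  have hv := toReal_trace_pos hσ hσ' hTσ
  set u := (trace ρ).toReal
  set v := (trace σ).toReal with hvdef
  have ht : 0 < u / v := div_pos hu hv
  have htr : trace ((u / v) • σ) = ENNReal.ofReal (u / v) * trace σ := trace_smul ht.le
  have hTσ2 : trace ((u / v) • σ) < ⊤ := by
    rw [htr]
    exact ENNReal.mul_lt_top ENNReal.ofReal_lt_top hTσ
  have hQ2 : Q α z ρ ((u / v) • σ) < ⊤ := by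
    rw [Q_smul hα hz hσ ht]
    exact ENNReal.mul_lt_top ENNReal.ofReal_lt_top hQ
  obtain ⟨-, h1, h2⟩ := mul_toReal_trace_le hα hz hρ (smul_nonneg ht.le hσ) hTσ2 hQ2
  have htp : 0 < (u / v) ^ (α - 1) := Real.rpow_pos_of_pos ht _
  rw [htr, ENNReal.toReal_mul, ENNReal.toReal_ofReal ht.le, Q_smul hα hz hσ ht, ENNReal.toReal_mul,
    ENNReal.toReal_ofReal (Real.rpow_nonneg ht.le _), ← hvdef, div_mul_cancel₀ _ hv.ne',
    show 1 - α = -(α - 1) by ring, Real.rpow_neg ht.le] at h1 h2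
  rw [rpow_mul_rpow_eq_mul_div_rpow hu hv]
  have h3 : ((u / v) ^ (α - 1))⁻¹ * (Q α z ρ σ).toReal * (u / v) ^ (α - 1) =
      (Q α z ρ σ).toReal := by field_simp
  constructor
  · rw [← h3]
    exact mul_le_mul_of_nonneg_right (by linarith) htp.le
  · intro heq
    have h4 : ρ = (u / v) • σ := by
      refine h2 ?_
      rw [heq]
      field_simp
      ring
    refine ⟨(u / v)⁻¹, inv_pos.2 ht, ?_⟩
    rw [h4, smul_smul, inv_mul_cancel₀ ht.ne', one_smul]

/-- The tangent inequality for `u ^ α` at `v`, multiplied by `v ^ (1 - α)`. -/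
theorem add_le_rpow_mul_rpow {α u v : ℝ} (hα : 1 < α) (hu : 0 ≤ u) (hv : 0 < v) :
    α * u + (1 - α) * v ≤ u ^ α * v ^ (1 - α) := by
  have h := tangent_le_rpow hv hα.le hu
  have h1 := mul_le_mul_of_nonneg_right h (Real.rpow_nonneg hv.le (1 - α))
  refine le_trans (le_of_eq ?_) h1
  have e1 : v ^ α * v ^ (1 - α) = v := by
    rw [← Real.rpow_add hv, add_sub_cancel, Real.rpow_one]
  have e2 : v ^ (α - 1) * v ^ (1 - α) = 1 := by
    rw [← Real.rpow_add hv, show α - 1 + (1 - α) = 0 by ring, Real.rpow_zero]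
  rw [add_mul, mul_assoc, e1, mul_assoc, mul_comm u, ← mul_assoc, mul_assoc α, e2]
  ring

theorem trace_rpow_mul_trace_rpow {α : ℝ} {ρ σ : H →L[ℂ] H} (hρ : 0 < (trace ρ).toReal)
    (hσ : 0 < (trace σ).toReal) (hTρ : trace ρ < ⊤) (hTσ : trace σ < ⊤) :
    trace ρ ^ α * trace σ ^ (1 - α) =
      ENNReal.ofReal ((trace ρ).toReal ^ α * (trace σ).toReal ^ (1 - α)) := by
  rw [ENNReal.ofReal_mul (Real.rpow_nonneg hρ.le _), ← ENNReal.ofReal_rpow_of_pos hρ,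
    ← ENNReal.ofReal_rpow_of_pos hσ, ENNReal.ofReal_toReal hTρ.ne, ENNReal.ofReal_toReal hTσ.ne]

theorem coe_affine_trace {α : ℝ} {ρ σ : H →L[ℂ] H} (hTρ : trace ρ < ⊤) (hTσ : trace σ < ⊤) :
    (α : EReal) * (trace ρ : EReal) + ((1 - α : ℝ) : EReal) * (trace σ : EReal) =
      ((α * (trace ρ).toReal + (1 - α) * (trace σ).toReal : ℝ) : EReal) := by
  rw [← EReal.coe_ennreal_toReal hTρ.ne, ← EReal.coe_ennreal_toReal hTσ.ne]
  norm_cast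

theorem rpow_mul_rpow_le_Q {α z : ℝ} (hα : 1 < α) (hz : 0 < z) {ρ σ : H →L[ℂ] H}
    (hρ : 0 ≤ ρ) (hρ' : ρ ≠ 0) (hσ : 0 ≤ σ) (hσ' : σ ≠ 0) (hTσ : trace σ < ⊤) :
    trace ρ ^ α * trace σ ^ (1 - α) ≤ Q α z ρ σ := by
  rcases eq_or_ne (Q α z ρ σ) ⊤ with hQ | hQ
  · rw [hQ]
    exact le_top
  have hTρ := (mul_toReal_trace_le hα hz hρ hσ hTσ hQ.lt_top).1
  rw [trace_rpow_mul_trace_rpow (toReal_trace_pos hρ hρ' hTρ) (toReal_trace_pos hσ hσ' hTσ) hTρ hTσ]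
  exact ENNReal.ofReal_le_of_le_toReal
    (rpow_mul_rpow_le_toReal_Q hα hz hρ hρ' hσ hσ' hTσ hQ.lt_top).1

theorem affine_trace_le_rpow_mul_rpow {α : ℝ} (hα : 1 < α) {ρ σ : H →L[ℂ] H}
    (hρ : 0 ≤ ρ) (hρ' : ρ ≠ 0) (hσ : 0 ≤ σ) (hσ' : σ ≠ 0) (hTσ : trace σ < ⊤) :
    (α : EReal) * (trace ρ : EReal) + ((1 - α : ℝ) : EReal) * (trace σ : EReal) ≤
      ((trace ρ ^ α * trace σ ^ (1 - α) : ENNReal) : EReal) := by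
  have hv := toReal_trace_pos hσ hσ' hTσ
  rcases eq_or_ne (trace ρ) ⊤ with hT | hT
  -- If `Tr ρ = ∞`, the product is infinite because its second factor is nonzero.
  · have h1 : trace σ ^ (1 - α) ≠ 0 := by
      rw [← ENNReal.ofReal_toReal hTσ.ne, ENNReal.ofReal_rpow_of_pos hv]
      simpa using Real.rpow_pos_of_pos hv _
    rw [hT, ENNReal.top_rpow_of_pos (by linarith), ENNReal.top_mul h1, EReal.coe_ennreal_top]
    exact le_top
  have hu := toReal_trace_pos hρ hρ' hT.lt_top
  rw [coe_affine_trace hT.lt_top hTσ, trace_rpow_mul_trace_rpow hu hv hT.lt_top hTσ,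
    EReal.coe_ennreal_ofReal, max_eq_left (by positivity)]
  exact EReal.coe_le_coe_iff.2 (add_le_rpow_mul_rpow hα hu.le hv)

theorem Q_eq_rpow_mul_rpow_iff {α z : ℝ} (hα : 1 < α) (hz : 0 < z) {ρ σ : H →L[ℂ] H}
    (hρ : 0 ≤ ρ) (hρ' : ρ ≠ 0) (hσ : 0 ≤ σ) (hσ' : σ ≠ 0) (hTσ : trace σ < ⊤)
    (hTρ : trace ρ < ⊤) :
    Q α z ρ σ = trace ρ ^ α * trace σ ^ (1 - α) ↔ ∃ η : ℝ, 0 < η ∧ σ = η • ρ := by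
  have hu := toReal_trace_pos hρ hρ' hTρ
  have hv := toReal_trace_pos hσ hσ' hTσ
  rw [trace_rpow_mul_trace_rpow hu hv hTρ hTσ]
  constructor
  · intro h
    refine (rpow_mul_rpow_le_toReal_Q hα hz hρ hρ' hσ hσ' hTσ (h ▸ ENNReal.ofReal_lt_top)).2 ?_
    rw [h, ENNReal.toReal_ofReal (by positivity)]
  · rintro ⟨η, hη, rfl⟩
    rw [Q_smul hα hz hρ hη, Q_self hα hz hρ, trace_smul hη.le, ENNReal.toReal_mul,
      ENNReal.toReal_ofReal hη.le, Real.mul_rpow hη.le hu.le]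
    nth_rw 1 [← ENNReal.ofReal_toReal hTρ.ne]
    rw [← ENNReal.ofReal_mul (Real.rpow_nonneg hη.le _)]
    congr 1
    rw [mul_left_comm, ← Real.rpow_add hu, add_sub_cancel, Real.rpow_one]

theorem Q_eq_affine_trace_iff {α z : ℝ} (hα : 1 < α) (hz : 0 < z) {ρ σ : H →L[ℂ] H}
    (hρ : 0 ≤ ρ) (hσ : 0 ≤ σ) (hTσ : trace σ < ⊤) (hTρ : trace ρ < ⊤) :
    (Q α z ρ σ : EReal) =
      (α : EReal) * (trace ρ : EReal) + ((1 - α : ℝ) : EReal) * (trace σ : EReal) ↔ σ = ρ := by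
  rw [coe_affine_trace hTρ hTσ]
  constructor
  · intro h
    have hQ : Q α z ρ σ ≠ ⊤ := by
      intro hT
      rw [hT, EReal.coe_ennreal_top] at h
      exact EReal.coe_ne_top _ h.symm
    rw [← EReal.coe_ennreal_toReal hQ, EReal.coe_eq_coe_iff] at h
    exact ((mul_toReal_trace_le hα hz hρ hσ hTσ hQ.lt_top).2.2 h).symm
  · rintro rfl
    rw [Q_self hα hz hρ, ← EReal.coe_ennreal_toReal hTρ.ne, EReal.coe_eq_coe_iff]
    ring

theorem IsDensity.ne_zero {A : H →L[ℂ] H} (hA : IsDensity A) : A ≠ 0 := by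
  rintro rfl
  have h := hA.2
  have h0 : trace (0 : H →L[ℂ] H) = 0 := by
    have := trace_smul (A := (0 : H →L[ℂ] H)) le_rfl
    rwa [zero_smul, ENNReal.ofReal_zero, zero_mul] at this
  rw [h0] at h
  exact zero_ne_one h

theorem one_le_Q_of_isDensity {α z : ℝ} (hα : 1 < α) (hz : 0 < z) {ρ σ : H →L[ℂ] H}
    (hρ : IsDensity ρ) (hσ : IsDensity σ) : 1 ≤ Q α z ρ σ := by
  have h := rpow_mul_rpow_le_Q hα hz hρ.1 hρ.ne_zero hσ.1 hσ.ne_zero (by simp [hσ.2])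
  rwa [hρ.2, hσ.2, ENNReal.one_rpow, ENNReal.one_rpow, one_mul] at h

theorem Q_eq_one_iff_of_isDensity {α z : ℝ} (hα : 1 < α) (hz : 0 < z) {ρ σ : H →L[ℂ] H}
    (hρ : IsDensity ρ) (hσ : IsDensity σ) : Q α z ρ σ = 1 ↔ ρ = σ := by
  have h := Q_eq_affine_trace_iff hα hz hρ.1 hσ.1 (by simp [hσ.2]) (by simp [hρ.2])
  rw [coe_affine_trace (by simp [hρ.2]) (by simp [hσ.2]), hρ.2, hσ.2, ENNReal.toReal_one, mul_one,
    mul_one, add_sub_cancel, EReal.coe_one, EReal.coe_ennreal_eq_one] at h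
  rw [h, eq_comm]

theorem D_nonneg_of_isDensity {α z : ℝ} (hα : 1 < α) (hz : 0 < z) {ρ σ : H →L[ℂ] H}
    (hρ : IsDensity ρ) (hσ : IsDensity σ) : 0 ≤ D α z ρ σ := by
  have h1 : 0 < 1 / (α - 1) := one_div_pos.2 (by linarith)
  exact mul_nonneg (EReal.coe_nonneg.2 h1.le)
    (ENNReal.zero_le_log_iff.2 (one_le_Q_of_isDensity hα hz hρ hσ))

theorem D_eq_zero_iff_of_isDensity {α z : ℝ} (hα : 1 < α) (hz : 0 < z) {ρ σ : H →L[ℂ] H}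
    (hρ : IsDensity ρ) (hσ : IsDensity σ) : D α z ρ σ = 0 ↔ ρ = σ := by
  have h1 : 0 < 1 / (α - 1) := one_div_pos.2 (by linarith)
  rw [D, mul_eq_zero, EReal.coe_eq_zero, or_iff_right h1.ne', ENNReal.log_eq_one_iff,
    Q_eq_one_iff_of_isDensity hα hz hρ hσ]

end Divergence

end RenyiAZ

theorem mainTheorem10 {H : Type*} [NormedAddCommGroup H] [InnerProductSpace ℂ H] [CompleteSpace H]
    [TopologicalSpace.SeparableSpace H] (α z : ℝ) (hα : 1 < α) (hz : 0 < z) :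
    (∀ ρ σ : H →L[ℂ] H, 0 ≤ ρ → ρ ≠ 0 → 0 ≤ σ → σ ≠ 0 → RenyiAZ.trace σ < ⊤ →
      (RenyiAZ.trace ρ ^ α * RenyiAZ.trace σ ^ (1 - α) ≤ RenyiAZ.Q α z ρ σ ∧
        (α : EReal) * (RenyiAZ.trace ρ : EReal)
            + ((1 - α : ℝ) : EReal) * (RenyiAZ.trace σ : EReal)
          ≤ ((RenyiAZ.trace ρ ^ α * RenyiAZ.trace σ ^ (1 - α) : ENNReal) : EReal)) ∧
      (RenyiAZ.trace ρ < ⊤ →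
        (RenyiAZ.Q α z ρ σ = RenyiAZ.trace ρ ^ α * RenyiAZ.trace σ ^ (1 - α) ↔
          ∃ η : ℝ, 0 < η ∧ σ = η • ρ) ∧
        ((RenyiAZ.Q α z ρ σ : EReal) =
            (α : EReal) * (RenyiAZ.trace ρ : EReal)
              + ((1 - α : ℝ) : EReal) * (RenyiAZ.trace σ : EReal) ↔
          σ = ρ))) ∧
    (∀ ρ σ : H →L[ℂ] H, RenyiAZ.IsDensity ρ → RenyiAZ.IsDensity σ →
      0 ≤ RenyiAZ.D α z ρ σ ∧ (RenyiAZ.D α z ρ σ = 0 ↔ ρ = σ)) :=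
  ⟨fun _ _ hρ hρ' hσ hσ' hTσ =>
    ⟨⟨RenyiAZ.rpow_mul_rpow_le_Q hα hz hρ hρ' hσ hσ' hTσ,
      RenyiAZ.affine_trace_le_rpow_mul_rpow hα hρ hρ' hσ hσ' hTσ⟩,
      fun hTρ => ⟨RenyiAZ.Q_eq_rpow_mul_rpow_iff hα hz hρ hρ' hσ hσ' hTσ hTρ,
        RenyiAZ.Q_eq_affine_trace_iff hα hz hρ hσ hTσ hTρ⟩⟩,
    fun _ _ hρ hσ => ⟨RenyiAZ.D_nonneg_of_isDensity hα hz hρ hσ,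
      RenyiAZ.D_eq_zero_iff_of_isDensity hα hz hρ hσ⟩⟩
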